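/- Let $\mathfrak H_a=\mathrm{span}_{\mathbb C}\{|k\rangle : k=0,1,2,\dots\}$ and, for $p\in\mathbb C$, let $$A_0(p)=\sum_{k\ge 0}(p-k)\,|k\rangle\langle k|,\qquad A_+(p)=\sum_{k\ge 0}(k-2p)\,|k\rangle\langle k+1|,\qquad A_-=\sum_{k\ge 0}(k+1)\,|k+1\rangle\langle k| .$$ On a chain of $n$ spins with space $(\mathbb C^2)^{\otimes n}$, let $\sigma^0=1$, $\sigma^+=\begin{pmatrix}0&1\\0&0\end{pmatrix}$, $\sigma^-=\begin{pmatrix}0&0\\1&0\end{pmatrix}$, with a subscript $k$ for the action on site $k$, and define the Lax operators $$L_k(p)=\sigma_k^0\otimes A_0(p)+\sigma_k^+\otimes A_+(p)+\sigma_k^-\otimes A_-,\qquad 1\le k\le n,$$ and the transfer operator $S(p)=\langle 0|L_1(p)L_2(p)\cdots L_n(p)|0\rangle\in\mathrm{End}((\mathbb C^2)^{\otimes n})$. With two copies of $\mathfrak H_a$, write $L_{a_1k}(p)$ and $L_{a_2k}(p)$ for $L_k(p)$ acting in the first and in the second copy. For $x\in\mathbb C\setminus\frac12\mathbb Z_{\ge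 0}$ let $f_m(x)=(x-m/2)^{-1}$ and let $H(x)=\bigoplus_{\alpha\ge 0}H^{(\alpha)}(x)$ be the operator on $\mathfrak H_a\otimes\mathfrak H_a$ that is block diagonal over the sectors $\mathrm{span}\{|k,\alpha-k\rangle : 0\le k\le\alpha\}$, that is, $H(x)=\sum_{\alpha}\sum_{k,l=0}^{\alpha}H^{(\alpha)}_{k,l}(x)\,|k,\alpha-k\rangle\langle l,\alpha-l|$, with $$H^{(\alpha)}_{k,l}(x)=\frac{(-1)^{k-l-1}}{2}\binom kl\sum_{m=l}^{k-1}(-1)^{m-l}\binom{k-l-1}{m-l}f_m(x)\quad(k\ge l+1),$$ $$H^{(\alpha)}_{k,k}(x)=-\frac12\sum_{m=k}^{\alpha-k-1}f_m(x)\quad(2k\le\alpha),\qquad H^{(\alpha)}_{\alpha-k,\alpha-l}(x)=-H^{(\alpha)}_{k,l}(x).$$ Then for all $x\in\mathbb C\setminus\frac12\mathbb Z_{\ge 0}$ and all $y\in\mathbb C$ the operator $$\check R\left(x+\tfrac y2,\,x-\tfrac y2\right)=\exp\big(y\,H(x)\big)$$ (the exponential is taken block by block), with $p=x+\frac y2$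 and $p'=x-\frac y2$, satisfies the RLL relation $$\check R(p,p')\,L_{a_1k}(p)\,L_{a_2k}(p')=L_{a_1k}(p')\,L_{a_2k}(p)\,\check R(p,p')$$ for every chain length $n$ and every site $k$, and it fixes the product vacuum: $\check R(p,p')|0,0\rangle=|0,0\rangle$ and $\langle 0,0|\check R(p,p')=\langle 0,0|$. Moreover, for every $n$ and all $p,p'\in\mathbb C$, $$[S(p),S(p')]=0 .$$ -/

import Mathlib

open scoped TensorProduct

noncomputable section

namespace ExteriorIntegrability

/-! ### The auxiliary space and its tridiagonal operators -/

/-- The auxiliary space: the complex linear span of kets `|0⟩, |1⟩, |2⟩, …`. -/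
abbrev Aux : Type := ℕ →₀ ℂ

/-- The basis vector `|k⟩`. -/
def ket (k : ℕ) : Aux := Finsupp.single k 1

/-- The amplitude `a⁰_k(p) = p - k`. -/
def ampZero (p : ℂ) (k : ℕ) : ℂ := p - k

/-- The amplitude `a⁺_k(p) = k - 2p`. -/
def ampPlus (p : ℂ) (k : ℕ) : ℂ := k - 2 * p

/-- The amplitude `a⁻_k = k + 1`. -/
def ampMinus (k : ℕ) : ℂ := k + 1

/-- `A₀(p) = ∑ₖ a⁰_k(p) |k⟩⟨k|`. -/
def opZero (p : ℂ) : Module.End ℂ Aux :=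
  Finsupp.linearCombination ℂ fun k => ampZero p k • ket k

/-- `A₊(p) = ∑ₖ a⁺_k(p) |k⟩⟨k+1|`. -/
def opPlus (p : ℂ) : Module.End ℂ Aux :=
  Finsupp.linearCombination ℂ fun j =>
    match j with
    | 0 => 0
    | k + 1 => ampPlus p k • ket k

/-- `A₋ = ∑ₖ a⁻_k |k+1⟩⟨k|`. -/
def opMinus : Module.End ℂ Aux :=
  Finsupp.linearCombination ℂ fun k => ampMinus k • ket (k + 1)

/-! ### The spin chain and the Lax operator -/

/-- `σ⁰`, the identity. -/
def sigmaZero : Matrix (Fin 2) (Fin 2) ℂ := 1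

/-- `σ⁺ = (σˣ + iσʸ)/2`. -/
def sigmaPlus : Matrix (Fin 2) (Fin 2) ℂ := !![0, 1; 0, 0]

/-- `σ⁻ = (σˣ - iσʸ)/2`. -/
def sigmaMinus : Matrix (Fin 2) (Fin 2) ℂ := !![0, 0; 1, 0]

/-- The `n`-site chain `(ℂ²)^{⊗n}` is represented by its computational basis `|ν₁,…,νₙ⟩`,
`ν_j ∈ {0, 1}`; operators on it are matrices indexed by `Config n`. -/
abbrev Config (n : ℕ) : Type := Fin n → Fin 2

/-- The one-site operator `M` acting on site `k` of the chain and as the identity elsewhere. -/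
def atSite {n : ℕ} (k : Fin n) (M : Matrix (Fin 2) (Fin 2) ℂ) :
    Matrix (Config n) (Config n) ℂ :=
  Matrix.of fun ν ν' => if ∀ j, j ≠ k → ν j = ν' j then M (ν k) (ν' k) else 0

/-- `M ⊗ A`, an operator on (spins) ⊗ (auxiliary space), written as a matrix in the spin basis
whose entries are operators on the auxiliary space. -/
def opTensor {ι V : Type*} [AddCommMonoid V] [Module ℂ V]
    (M : Matrix ι ι ℂ) (A : Module.End ℂ V) : Matrix ι ι (Module.End ℂ V) :=
  M.map fun c => c • A

/-- The Lax operator `L_k(p) = σ⁰_k ⊗ A₀(p) + σ⁺_k ⊗ A₊(p) + σ⁻_k ⊗ A₋`. -/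
def lax {n : ℕ} (k : Fin n) (p : ℂ) : Matrix (Config n) (Config n) (Module.End ℂ Aux) :=
  opTensor (atSite k sigmaZero) (opZero p) + opTensor (atSite k sigmaPlus) (opPlus p)
    + opTensor (atSite k sigmaMinus) opMinus

/-- The monodromy matrix `T(p) = L₁(p) L₂(p) ⋯ Lₙ(p)`. -/
def monodromy (n : ℕ) (p : ℂ) : Matrix (Config n) (Config n) (Module.End ℂ Aux) :=
  (List.ofFn fun k : Fin n => lax k p).prod

/-- The vacuum-contracted transfer operator `S(p) = ⟨0|T(p)|0⟩`. -/
def transfer (n : ℕ) (p : ℂ) : Matrix (Config n) (Config n) ℂ :=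
  (monodromy n p).map fun A => A (ket 0) 0

/-! ### Two copies of the auxiliary space -/

/-- `L_{a₁k}(p)`, the Lax operator acting in the first of two auxiliary spaces. -/
def laxFst {n : ℕ} (k : Fin n) (p : ℂ) :
    Matrix (Config n) (Config n) (Module.End ℂ (Aux ⊗[ℂ] Aux)) :=
  (lax k p).map fun A => TensorProduct.map A LinearMap.id

/-- `L_{a₂k}(p)`, the Lax operator acting in the second of two auxiliary spaces. -/
def laxSnd {n : ℕ} (k : Fin n) (p : ℂ) :
    Matrix (Config n) (Config n) (Module.End ℂ (Aux ⊗[ℂ] Aux)) :=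
  (lax k p).map fun A => TensorProduct.map LinearMap.id A

/-- An operator on the two auxiliary spaces, acting as the identity on the spins. -/
def onAux {n : ℕ} (R : Module.End ℂ (Aux ⊗[ℂ] Aux)) :
    Matrix (Config n) (Config n) (Module.End ℂ (Aux ⊗[ℂ] Aux)) :=
  opTensor 1 R

/-- The basis `|k, l⟩ = |k⟩ ⊗ |l⟩` of the product of the two auxiliary spaces. -/
def ketBasis : Module.Basis (ℕ × ℕ) ℂ (Aux ⊗[ℂ] Aux) :=
  Finsupp.basisSingleOne.tensorProduct Finsupp.basisSingleOne

/-- The block-diagonal operator `⨁_α X^{(α)} = ∑_α ∑_{k,l ≤ α} X^{(α)}_{k,l} |k,α-k⟩⟨l,α-l|`. -/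
def blockSum (X : ∀ α : ℕ, Matrix (Fin (α + 1)) (Fin (α + 1)) ℂ) :
    Module.End ℂ (Aux ⊗[ℂ] Aux) :=
  ketBasis.constr ℂ fun b =>
    ∑ k : Fin (b.1 + b.2 + 1),
      X (b.1 + b.2) k ⟨b.1, by omega⟩ • ketBasis ((k : ℕ), b.1 + b.2 - (k : ℕ))

/-- `E = exp X` on the product of the two auxiliary spaces: every matrix element of the exponential
series of `X` converges to that of `E`. -/
def IsExpOf (E X : Module.End ℂ (Aux ⊗[ℂ] Aux)) : Prop :=
  ∀ b c : ℕ × ℕ, HasSum (fun j : ℕ => ((j.factorial : ℂ))⁻¹ *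
    ketBasis.coord b ((X ^ j) (ketBasis c))) (ketBasis.coord b (E (ketBasis c)))

/-! ### The generator and the braided exterior R-matrix -/

/-- The simple-pole function `f_m(x) = (x - m/2)⁻¹`. -/
def pole (m : ℕ) (x : ℂ) : ℂ := (x - (m : ℂ) / 2)⁻¹

/-- The matrix element of the generator below the diagonal, `k ≥ l + 1`:
`((-1)^(k-l-1)/2) * C(k,l) * ∑_{m=l}^{k-1} (-1)^(m-l) * C(k-l-1, m-l) * f_m(x)`. -/
def genLower (k l : ℕ) (x : ℂ) : ℂ :=
  (-1) ^ (k - l - 1) / 2 * (k.choose l : ℂ) *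
    ∑ m ∈ Finset.Ico l k, (-1) ^ (m - l) * ((k - l - 1).choose (m - l) : ℂ) * pole m x

/-- The diagonal matrix element of the generator for `2k ≤ α`:
`-(1/2) * ∑_{m=k}^{α-k-1} f_m(x)`. -/
def genDiag (α k : ℕ) (x : ℂ) : ℂ :=
  -(1 / 2) * ∑ m ∈ Finset.Ico k (α - k), pole m x

/-- The block `H^{(α)}(x)`; the elements above the diagonal and those in the lower half of the
diagonal are fixed by the antisymmetry `H_{α-k,α-l} = -H_{k,l}`. -/
def genBlock (α : ℕ) (x : ℂ) : Matrix (Fin (α + 1)) (Fin (α + 1)) ℂ :=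
  Matrix.of fun k l =>
    if l < k then genLower k l x
    else if k < l then -genLower (α - (k : ℕ)) (α - (l : ℕ)) x
    else if 2 * (k : ℕ) ≤ α then genDiag α k x
    else -genDiag α (α - (k : ℕ)) x

/-- The generator `H(x) = ⨁_α H^{(α)}(x)`. -/
def gen (x : ℂ) : Module.End ℂ (Aux ⊗[ℂ] Aux) := blockSum fun α => genBlock α x

/-- The braided exterior R-matrix as a function of `(p, p')`: the exponential of
`(p - p') H((p + p')/2)`, taken block by block. -/
def rMatrix (p p' : ℂ) : Module.End ℂ (Aux ⊗[ℂ] Aux) :=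
  blockSum fun α => NormedSpace.exp ((p - p') • genBlock α ((p + p') / 2))

end ExteriorIntegrability

end

open scoped TensorProduct

noncomputable section

namespace ExteriorIntegrability

/-! ### The generator as a difference of two functions of Weyl-algebra elements -/

section Algebraic

/-! ### Derivation rules for the commutator -/

section Bracket

variable {A : Type*} [Ring A]

/-! Put E = A₋ and T = ∑ₖ |k⟩⟨k+1|. Then [T, E] = 1, A₀(p) = p - ET and A₊(p) = (ET - 2p)T, so two
auxiliary spaces carry a two-mode Weyl algebra. Write P = T₁ + T₂ and Nᵢ = EᵢP. A linear change of
variables (`shear`) carries E₁T₁ to N₁, so functions of N₁, and by exchange of N₂, make sense. The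
key fact is H(x) = Φ₁ - Φ₂ with Φᵢ = h(Nᵢ) and h(k) = ∑_{m<k} 1/(2x - m) (`gen_eq`): the binomial
sums in H are Newton differences of h. Since h(k+1) - h(k) = 1/(2x - k), commutators of Φᵢ with the
Weyl generators involve only the resolvents s = (2x - N₁)⁻¹ and t = (2x - N₂)⁻¹; `DigammaPair`
collects these rules.

With p = x + y/2 and p' = x - y/2, each entry of the product of two one-site Lax matrices is a
polynomial Z(y) of degree at most 2, and exchanging p and p' is y ↦ -y. The RLL relation thus reads
exp(yH) Z(y) = Z(-y) exp(yH). Put σ = sP and τ = tP. The resolvent identity shows that H commutes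
with σ, τ and E₁ - E₂, while [H, T₁] = -σ and [H, T₂] = τ. Hence iterated commutators of the entries
with H stop by the fourth step, conjugation by exp(yH) is a finite sum
(`IsWeakExp.mul_eq_of_bracket`), and the powers of y match.

The transfer operators then commute by the train argument: the R-matrix is pulled through the chain
site by site and absorbed by the vacuum on both sides. This needs p + p' ∉ ℕ; density and continuity
of S remove the restriction. -/

theorem bracket_mul (a b c : A) : ⁅a, b * c⁆ = ⁅a, b⁆ * c + b * ⁅a, c⁆ := by
  simp only [Ring.lie_def]; noncomm_ring

theorem bracket_one (a : A) : ⁅a, (1 : A)⁆ = 0 := by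
  simp [Ring.lie_def]

theorem bracket_add (a b c : A) : ⁅a, b + c⁆ = ⁅a, b⁆ + ⁅a, c⁆ := by
  simp only [Ring.lie_def]; noncomm_ring

theorem bracket_sub (a b c : A) : ⁅a, b - c⁆ = ⁅a, b⁆ - ⁅a, c⁆ := by
  simp only [Ring.lie_def]; noncomm_ring

theorem bracket_neg (a b : A) : ⁅a, -b⁆ = -⁅a, b⁆ := by
  simp only [Ring.lie_def]; noncomm_ring

theorem bracket_zero (a : A) : ⁅a, (0 : A)⁆ = 0 := by
  simp [Ring.lie_def]

theorem sub_bracket (a b c : A) : ⁅a - b, c⁆ = ⁅a, c⁆ - ⁅b, c⁆ := by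
  simp only [Ring.lie_def]; noncomm_ring

theorem neg_bracket (a b : A) : ⁅-a, b⁆ = -⁅a, b⁆ := by
  simp only [Ring.lie_def]; noncomm_ring

theorem bracket_smul {𝕜 : Type*} [CommSemiring 𝕜] [Algebra 𝕜 A] (c : 𝕜) (a b : A) :
    ⁅a, c • b⁆ = c • ⁅a, b⁆ := by
  simp only [Ring.lie_def, mul_smul_comm, smul_mul_assoc, smul_sub]

end Bracket

variable {A : Type*} [Ring A] [Algebra ℂ A]

/-- Two Weyl pairs `(T₁, E₁)`, `(T₂, E₂)`, the resolvents `s`, `t` of `E₁ (T₁ + T₂)` and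
`E₂ (T₁ + T₂)` at `2x`, and elements `Φ₁`, `Φ₂` whose commutators with the Weyl pairs are those of
a digamma function of `E₁ (T₁ + T₂)` and of `E₂ (T₁ + T₂)`. -/
structure DigammaPair (x : ℂ) (E₁ E₂ T₁ T₂ Φ₁ Φ₂ s t : A) : Prop where
  ee : E₁ * E₂ = E₂ * E₁
  tt : T₁ * T₂ = T₂ * T₁
  te₁₁ : T₁ * E₁ = E₁ * T₁ + 1
  te₂₂ : T₂ * E₂ = E₂ * T₂ + 1
  te₁₂ : T₁ * E₂ = E₂ * T₁
  te₂₁ : T₂ * E₁ = E₁ * T₂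
  Φ₁T₁ : ⁅Φ₁, T₁⁆ = -(s * (T₁ + T₂))
  Φ₁T₂ : ⁅Φ₁, T₂⁆ = 0
  Φ₁E₁ : ⁅Φ₁, E₁⁆ = E₁ * s
  Φ₁E₂ : ⁅Φ₁, E₂⁆ = E₁ * s
  Φ₂T₁ : ⁅Φ₂, T₁⁆ = 0
  Φ₂T₂ : ⁅Φ₂, T₂⁆ = -(t * (T₁ + T₂))
  Φ₂E₁ : ⁅Φ₂, E₁⁆ = E₂ * t
  Φ₂E₂ : ⁅Φ₂, E₂⁆ = E₂ * t
  mul_s : ((2 * x) • 1 - E₁ * (T₁ + T₂)) * s = 1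
  s_mul : s * ((2 * x) • 1 - E₁ * (T₁ + T₂)) = 1
  mul_t : ((2 * x) • 1 - E₂ * (T₁ + T₂)) * t = 1
  t_mul : t * ((2 * x) • 1 - E₂ * (T₁ + T₂)) = 1

namespace DigammaPair

variable {x : ℂ} {E₁ E₂ T₁ T₂ Φ₁ Φ₂ s t : A}

/-- The rules are symmetric under 1 ↔ 2 with s ↔ t, so each fact proved for one index yields its
mirror image. The difference Φ₁ - Φ₂ changes sign. -/
theorem swap (h : DigammaPair x E₁ E₂ T₁ T₂ Φ₁ Φ₂ s t) :
    DigammaPair x E₂ E₁ T₂ T₁ Φ₂ Φ₁ t s where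
  ee := h.ee.symm
  tt := h.tt.symm
  te₁₁ := h.te₂₂
  te₂₂ := h.te₁₁
  te₁₂ := h.te₂₁
  te₂₁ := h.te₁₂
  Φ₁T₁ := by rw [add_comm]; exact h.Φ₂T₂
  Φ₁T₂ := h.Φ₂T₁
  Φ₁E₁ := h.Φ₂E₂
  Φ₁E₂ := h.Φ₂E₁
  Φ₂T₁ := h.Φ₁T₂
  Φ₂T₂ := by rw [add_comm]; exact h.Φ₁T₁
  Φ₂E₁ := h.Φ₁E₂
  Φ₂E₂ := h.Φ₁E₁
  mul_s := by rw [add_comm]; exact h.mul_t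
  s_mul := by rw [add_comm]; exact h.t_mul
  mul_t := by rw [add_comm]; exact h.mul_s
  t_mul := by rw [add_comm]; exact h.s_mul

theorem Φ₁_sum (h : DigammaPair x E₁ E₂ T₁ T₂ Φ₁ Φ₂ s t) :
    ⁅Φ₁, T₁ + T₂⁆ = -(s * (T₁ + T₂)) := by
  rw [bracket_add, h.Φ₁T₁, h.Φ₁T₂, add_zero]

theorem Φ₂_sum (h : DigammaPair x E₁ E₂ T₁ T₂ Φ₁ Φ₂ s t) :
    ⁅Φ₂, T₁ + T₂⁆ = -(t * (T₁ + T₂)) := by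
  rw [bracket_add, h.Φ₂T₁, h.Φ₂T₂, zero_add]

theorem Φ₁_diff (h : DigammaPair x E₁ E₂ T₁ T₂ Φ₁ Φ₂ s t) : ⁅Φ₁, E₁ - E₂⁆ = 0 := by
  rw [bracket_sub, h.Φ₁E₁, h.Φ₁E₂, sub_self]

theorem Φ₂_diff (h : DigammaPair x E₁ E₂ T₁ T₂ Φ₁ Φ₂ s t) : ⁅Φ₂, E₁ - E₂⁆ = 0 := by
  rw [bracket_sub, h.Φ₂E₁, h.Φ₂E₂, sub_self]

theorem mul_s_eq (h : DigammaPair x E₁ E₂ T₁ T₂ Φ₁ Φ₂ s t) :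
    E₁ * (T₁ + T₂) * s = (2 * x) • s - 1 := by
  have := h.mul_s
  rw [sub_mul, smul_mul_assoc, one_mul] at this
  rw [← this]; abel

theorem s_mul_eq (h : DigammaPair x E₁ E₂ T₁ T₂ Φ₁ Φ₂ s t) :
    s * (E₁ * (T₁ + T₂)) = (2 * x) • s - 1 := by
  have := h.s_mul
  rw [mul_sub, mul_smul_comm, mul_one] at this
  rw [← this]; abel

theorem Φ₁_number (h : DigammaPair x E₁ E₂ T₁ T₂ Φ₁ Φ₂ s t) : ⁅Φ₁, E₁ * (T₁ + T₂)⁆ = 0 := by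
  rw [bracket_mul, h.Φ₁E₁, h.Φ₁_sum]; noncomm_ring

theorem Φ₂_number (h : DigammaPair x E₁ E₂ T₁ T₂ Φ₁ Φ₂ s t) : ⁅Φ₂, E₂ * (T₁ + T₂)⁆ = 0 := by
  rw [bracket_mul, h.Φ₂E₂, h.Φ₂_sum]; noncomm_ring

/-- The commutator with the resolvent `s`. -/
theorem bracket_s (h : DigammaPair x E₁ E₂ T₁ T₂ Φ₁ Φ₂ s t) (Y : A) :
    ⁅Y, s⁆ = s * ⁅Y, E₁ * (T₁ + T₂)⁆ * s := by
  have h1 : ⁅Y, E₁ * (T₁ + T₂)⁆ = -⁅Y, (2 * x) • (1 : A) - E₁ * (T₁ + T₂)⁆ := by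
    rw [bracket_sub, bracket_smul, bracket_one, smul_zero]; abel
  rw [h1, Ring.lie_def, Ring.lie_def, neg_sub, mul_sub, sub_mul, ← mul_assoc s, h.s_mul, one_mul,
    mul_assoc s, mul_assoc Y, h.mul_s, mul_one]

/-- The two canonical commutators contribute opposite units. -/
theorem diff_comm_sum (h : DigammaPair x E₁ E₂ T₁ T₂ Φ₁ Φ₂ s t) :
    ⁅E₁ - E₂, T₁ + T₂⁆ = 0 := by
  simp only [Ring.lie_def, sub_mul, mul_add, mul_sub, add_mul, h.te₁₁, h.te₁₂, h.te₂₁, h.te₂₂]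
  abel

theorem diff_comm_number (h : DigammaPair x E₁ E₂ T₁ T₂ Φ₁ Φ₂ s t) :
    ⁅E₁ - E₂, E₁ * (T₁ + T₂)⁆ = 0 := by
  rw [bracket_mul, h.diff_comm_sum, Ring.lie_def, mul_sub, sub_mul E₁, h.ee]; simp

theorem diff_comm_s (h : DigammaPair x E₁ E₂ T₁ T₂ Φ₁ Φ₂ s t) : ⁅E₁ - E₂, s⁆ = 0 := by
  rw [h.bracket_s, h.diff_comm_number]; simp

theorem diff_comm_t (h : DigammaPair x E₁ E₂ T₁ T₂ Φ₁ Φ₂ s t) : ⁅E₁ - E₂, t⁆ = 0 := by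
  have := h.swap.diff_comm_s
  rw [← neg_sub, neg_bracket, this, neg_zero]

theorem T₂_comm_s (h : DigammaPair x E₁ E₂ T₁ T₂ Φ₁ Φ₂ s t) : ⁅T₂, s⁆ = 0 := by
  have : ⁅T₂, E₁ * (T₁ + T₂)⁆ = 0 := by
    rw [bracket_mul, Ring.lie_def, Ring.lie_def, h.te₂₁, mul_add T₂, add_mul T₁, h.tt]; simp
  rw [h.bracket_s, this]; simp

theorem Φ₁_comm_s (h : DigammaPair x E₁ E₂ T₁ T₂ Φ₁ Φ₂ s t) : ⁅Φ₁, s⁆ = 0 := by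
  rw [h.bracket_s, h.Φ₁_number]; simp

/-- `s = t + (E₁ - E₂) t (T₁ + T₂) s`. -/
theorem resolvent_left (h : DigammaPair x E₁ E₂ T₁ T₂ Φ₁ Φ₂ s t) :
    s = t + (E₁ - E₂) * (t * (T₁ + T₂)) * s := by
  have hc : (E₁ - E₂) * t = t * (E₁ - E₂) := sub_eq_zero.1 h.diff_comm_t
  -- The second resolvent identity, with N₁ - N₂ = (E₁ - E₂)P; the factor E₁ - E₂ can be moved past
  -- t.
  have h2 : ((2 * x) • (1 : A) - E₂ * (T₁ + T₂)) * s = 1 + (E₁ - E₂) * (T₁ + T₂) * s := by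
    rw [sub_mul, smul_mul_assoc, one_mul, sub_mul, sub_mul, h.mul_s_eq]; abel
  calc s = t * (((2 * x) • (1 : A) - E₂ * (T₁ + T₂)) * s) := by
        rw [← mul_assoc, h.t_mul, one_mul]
    _ = _ := by rw [h2, mul_add, mul_one, ← mul_assoc (E₁ - E₂), hc]; simp only [mul_assoc]

/-- The crossed commutator. Since N₁ = N₂ + (E₁ - E₂)P, only P fails to commute with Φ₂, and the
resulting terms -s((E₁ - E₂)tPs + t)P collapse to -s²P by the resolvent identity. This is exactly
the value of the uncrossed commutator in `Φ₁_sigma`. -/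
theorem Φ₂_sigma (h : DigammaPair x E₁ E₂ T₁ T₂ Φ₁ Φ₂ s t) :
    ⁅Φ₂, s * (T₁ + T₂)⁆ = -(s * (s * (T₁ + T₂))) := by
  have h1 : ⁅Φ₂, E₁ * (T₁ + T₂)⁆ = -((E₁ - E₂) * (t * (T₁ + T₂))) := by
    have : E₁ * (T₁ + T₂) = (E₁ - E₂) * (T₁ + T₂) + E₂ * (T₁ + T₂) := by
      rw [← add_mul]; simp
    rw [this, bracket_add, h.Φ₂_number, bracket_mul, h.Φ₂_diff, h.Φ₂_sum]; simp
  rw [bracket_mul, h.bracket_s, h1, h.Φ₂_sum]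
  conv_rhs => enter [1, 2, 1]; rw [h.resolvent_left]
  noncomm_ring

theorem Φ₁_sigma (h : DigammaPair x E₁ E₂ T₁ T₂ Φ₁ Φ₂ s t) :
    ⁅Φ₁, s * (T₁ + T₂)⁆ = -(s * (s * (T₁ + T₂))) := by
  rw [bracket_mul, h.Φ₁_comm_s, h.Φ₁_sum]; simp

/-- The reason the iterated commutators terminate: T₁ is sent to -σ, and σ is annihilated. -/
theorem gen_sigma (h : DigammaPair x E₁ E₂ T₁ T₂ Φ₁ Φ₂ s t) :
    ⁅Φ₁ - Φ₂, s * (T₁ + T₂)⁆ = 0 := by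
  rw [sub_bracket, h.Φ₁_sigma, h.Φ₂_sigma, sub_self]

theorem gen_tau (h : DigammaPair x E₁ E₂ T₁ T₂ Φ₁ Φ₂ s t) :
    ⁅Φ₁ - Φ₂, t * (T₁ + T₂)⁆ = 0 := by
  rw [← neg_sub, neg_bracket, add_comm T₁, h.swap.gen_sigma, neg_zero]

theorem gen_diff (h : DigammaPair x E₁ E₂ T₁ T₂ Φ₁ Φ₂ s t) : ⁅Φ₁ - Φ₂, E₁ - E₂⁆ = 0 := by
  rw [sub_bracket, h.Φ₁_diff, h.Φ₂_diff, sub_self]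

theorem gen_T₁ (h : DigammaPair x E₁ E₂ T₁ T₂ Φ₁ Φ₂ s t) :
    ⁅Φ₁ - Φ₂, T₁⁆ = -(s * (T₁ + T₂)) := by
  rw [sub_bracket, h.Φ₁T₁, h.Φ₂T₁, sub_zero]

theorem gen_T₂ (h : DigammaPair x E₁ E₂ T₁ T₂ Φ₁ Φ₂ s t) :
    ⁅Φ₁ - Φ₂, T₂⁆ = t * (T₁ + T₂) := by
  rw [sub_bracket, h.Φ₁T₂, h.Φ₂T₂, zero_sub, neg_neg]

theorem sigma_sub_tau (h : DigammaPair x E₁ E₂ T₁ T₂ Φ₁ Φ₂ s t) :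
    (E₁ - E₂) * (t * (T₁ + T₂)) * (s * (T₁ + T₂)) = s * (T₁ + T₂) - t * (T₁ + T₂) := by
  rw [← mul_assoc, ← sub_mul]
  congr 1
  rw [eq_sub_iff_add_eq, add_comm, ← h.resolvent_left]

theorem sigma_sub_tau' (h : DigammaPair x E₁ E₂ T₁ T₂ Φ₁ Φ₂ s t) :
    (E₁ - E₂) * (s * (T₁ + T₂)) * (t * (T₁ + T₂)) = s * (T₁ + T₂) - t * (T₁ + T₂) := by
  have := h.swap.sigma_sub_tau
  rw [add_comm T₂, ← neg_sub, neg_mul, neg_mul] at this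
  rw [← neg_sub (t * (T₁ + T₂)), ← this, neg_neg]

end DigammaPair

end Algebraic

/-! ### Entries of the product of two Lax matrices and their commutators with the generator -/

section Entries

variable {A : Type*} [Ring A] [Algebra ℂ A]

/-- The `y⁰` part of the lower-left entry of the product of two Lax matrices. -/
def entryC₀ (x : ℂ) (E₁ E₂ T₁ T₂ : A) : A := x • (E₁ + E₂) - E₁ * E₂ * (T₁ + T₂)

/-- The `y⁰` part of the upper-left entry. -/
def entryA₀ (x : ℂ) (E₁ E₂ T₁ T₂ : A) : A :=
  (x ^ 2) • 1 - x • (E₂ * (T₁ + T₂)) - entryC₀ x E₁ E₂ T₁ T₂ * T₁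

/-- The `y¹` part of the upper-left entry. -/
def entryA₁ (E₁ E₂ T₁ T₂ : A) : A :=
  (1 / 2 : ℂ) • ((E₁ - E₂) * T₁ - E₂ * (T₁ + T₂))

/-- The `y⁰` part of the upper-right entry. -/
def entryB₀ (x : ℂ) (E₁ E₂ T₁ T₂ : A) : A :=
  -((2 * x ^ 2) • (T₁ + T₂)) + entryC₀ x E₁ E₂ T₁ T₂ * (T₁ * T₂)
    + x • ((E₁ * T₁ + E₂ * T₂) * (T₁ + T₂))

/-- The `y¹` part of the upper-right entry. -/
def entryB₁ (E₁ E₂ T₁ T₂ : A) : A :=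
  (1 / 2 : ℂ) • (E₂ * (T₂ * T₂) - E₁ * (T₁ * T₁)) - (E₁ - E₂) * (T₁ * T₂)

namespace DigammaPair

variable {x : ℂ} {E₁ E₂ T₁ T₂ Φ₁ Φ₂ s t : A}

theorem entryC₀_swap (h : DigammaPair x E₁ E₂ T₁ T₂ Φ₁ Φ₂ s t) :
    entryC₀ x E₂ E₁ T₂ T₁ = entryC₀ x E₁ E₂ T₁ T₂ := by
  rw [entryC₀, entryC₀, add_comm T₂, add_comm E₂, h.ee]

/-- As E₁E₂P = E₂N₁ and Φ₁ commutes with N₁, the commutator is 2xE₁s - E₁sN₁, in which the resolvent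
cancels. -/
theorem Φ₁_entryC₀ (h : DigammaPair x E₁ E₂ T₁ T₂ Φ₁ Φ₂ s t) :
    ⁅Φ₁, entryC₀ x E₁ E₂ T₁ T₂⁆ = E₁ := by
  rw [entryC₀, h.ee, mul_assoc, bracket_sub, bracket_smul, bracket_add, bracket_mul, h.Φ₁_number,
    h.Φ₁E₁, h.Φ₁E₂, mul_assoc, h.s_mul_eq, mul_sub, mul_smul_comm]
  simp only [mul_zero, mul_one]
  module

theorem Φ₂_entryC₀ (h : DigammaPair x E₁ E₂ T₁ T₂ Φ₁ Φ₂ s t) :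
    ⁅Φ₂, entryC₀ x E₁ E₂ T₁ T₂⁆ = E₂ := by
  rw [← h.entryC₀_swap, h.swap.Φ₁_entryC₀]

theorem gen_entryC₀ (h : DigammaPair x E₁ E₂ T₁ T₂ Φ₁ Φ₂ s t) :
    ⁅Φ₁ - Φ₂, entryC₀ x E₁ E₂ T₁ T₂⁆ = E₁ - E₂ := by
  rw [sub_bracket, h.Φ₁_entryC₀, h.Φ₂_entryC₀]

/-- Separates the part of C₀σ that still contains a resolvent. In A₀ and B₀ that part cancels
against the terms with explicit factors of x. -/
theorem entryC₀_sigma (h : DigammaPair x E₁ E₂ T₁ T₂ Φ₁ Φ₂ s t) :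
    entryC₀ x E₁ E₂ T₁ T₂ * (s * (T₁ + T₂))
      = x • ((E₁ - E₂) * (s * (T₁ + T₂))) + E₂ * (T₁ + T₂) := by
  have h1 : entryC₀ x E₁ E₂ T₁ T₂ * s = x • ((E₁ - E₂) * s) + E₂ := by
    rw [entryC₀, h.ee, mul_assoc, sub_mul, mul_assoc E₂, h.mul_s_eq]
    simp only [mul_sub, sub_mul, add_mul, smul_mul_assoc, mul_smul_comm, mul_one]
    module
  rw [← mul_assoc, h1, add_mul, smul_mul_assoc, mul_assoc]

theorem Φ₁_entryA₀ (h : DigammaPair x E₁ E₂ T₁ T₂ Φ₁ Φ₂ s t) :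
    ⁅Φ₁, entryA₀ x E₁ E₂ T₁ T₂⁆ = E₂ * (T₁ + T₂) - E₁ * T₁ := by
  have h1 : E₂ * (T₁ + T₂) = E₁ * (T₁ + T₂) - (E₁ - E₂) * (T₁ + T₂) := by
    rw [sub_mul]; abel
  have h2 : ⁅Φ₁, E₂ * (T₁ + T₂)⁆ = (E₁ - E₂) * (s * (T₁ + T₂)) := by
    rw [h1, bracket_sub, h.Φ₁_number, bracket_mul, h.Φ₁_diff, h.Φ₁_sum]; noncomm_ring
  rw [entryA₀, bracket_sub, bracket_sub, bracket_smul, bracket_one, bracket_smul, h2, bracket_mul,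
    h.Φ₁_entryC₀, h.Φ₁T₁, mul_neg, h.entryC₀_sigma]
  module

theorem Φ₂_entryA₀ (h : DigammaPair x E₁ E₂ T₁ T₂ Φ₁ Φ₂ s t) :
    ⁅Φ₂, entryA₀ x E₁ E₂ T₁ T₂⁆ = -(E₂ * T₁) := by
  rw [entryA₀, bracket_sub, bracket_sub, bracket_smul, bracket_one, bracket_smul, h.Φ₂_number,
    bracket_mul, h.Φ₂_entryC₀, h.Φ₂T₁]
  simp

/-- The first-order condition in y: the coefficient -2 turns +yA₁ into -yA₁ under conjugation. -/
theorem gen_entryA₀ (h : DigammaPair x E₁ E₂ T₁ T₂ Φ₁ Φ₂ s t) :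
    ⁅Φ₁ - Φ₂, entryA₀ x E₁ E₂ T₁ T₂⁆ = (-2 : ℂ) • entryA₁ E₁ E₂ T₁ T₂ := by
  rw [sub_bracket, h.Φ₁_entryA₀, h.Φ₂_entryA₀, entryA₁, sub_mul]
  module

theorem gen_entryA₁ (h : DigammaPair x E₁ E₂ T₁ T₂ Φ₁ Φ₂ s t) :
    ⁅Φ₁ - Φ₂, entryA₁ E₁ E₂ T₁ T₂⁆ = -((E₁ - E₂) * (s * (T₁ + T₂))) := by
  have h1 : E₂ * (T₁ + T₂) = E₁ * (T₁ + T₂) - (E₁ - E₂) * (T₁ + T₂) := by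
    rw [sub_mul]; abel
  have h2 : ⁅Φ₁, E₂ * (T₁ + T₂)⁆ = (E₁ - E₂) * (s * (T₁ + T₂)) := by
    rw [h1, bracket_sub, h.Φ₁_number, bracket_mul, h.Φ₁_diff, h.Φ₁_sum]; noncomm_ring
  rw [entryA₁, bracket_smul, bracket_sub, bracket_mul, h.gen_diff, h.gen_T₁, sub_bracket _ _ (E₂ * _),
    h2, h.Φ₂_number]
  simp only [zero_mul, mul_neg]
  module

theorem gen_diff_sigma (h : DigammaPair x E₁ E₂ T₁ T₂ Φ₁ Φ₂ s t) :
    ⁅Φ₁ - Φ₂, (E₁ - E₂) * (s * (T₁ + T₂))⁆ = 0 := by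
  rw [bracket_mul, h.gen_diff, h.gen_sigma]; simp

theorem entryB₀_swap (h : DigammaPair x E₁ E₂ T₁ T₂ Φ₁ Φ₂ s t) :
    entryB₀ x E₂ E₁ T₂ T₁ = entryB₀ x E₁ E₂ T₁ T₂ := by
  rw [entryB₀, entryB₀, add_comm T₂, h.tt, h.entryC₀_swap, add_comm (E₁ * T₁)]

theorem Φ₁_entryB₀ (h : DigammaPair x E₁ E₂ T₁ T₂ Φ₁ Φ₂ s t) :
    ⁅Φ₁, entryB₀ x E₁ E₂ T₁ T₂⁆
      = x • (T₁ + T₂) + E₁ * (T₁ * T₂) - E₂ * ((T₁ + T₂) * T₂) := by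
  have h1 : E₁ * T₁ + E₂ * T₂ = E₁ * (T₁ + T₂) - (E₁ - E₂) * T₂ := by
    rw [sub_mul, mul_add]; abel
  have h2 : T₂ * (s * (T₁ + T₂)) = s * (T₁ + T₂) * T₂ := by
    have := sub_eq_zero.1 h.T₂_comm_s
    rw [← mul_assoc, this, mul_assoc, mul_assoc, mul_add, add_mul, h.tt]
  rw [entryB₀, bracket_add, bracket_add, bracket_neg, bracket_smul, bracket_mul, h.Φ₁_entryC₀,
    bracket_mul _ T₁, h.Φ₁T₁, h.Φ₁T₂, bracket_smul, h1, bracket_mul, bracket_sub, h.Φ₁_number,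
    bracket_mul, h.Φ₁_diff, h.Φ₁T₂, h.Φ₁_sum]
  have h3 : entryC₀ x E₁ E₂ T₁ T₂ * (-(s * (T₁ + T₂)) * T₂ + T₁ * 0)
      = -(x • ((E₁ - E₂) * (s * (T₁ + T₂)) * T₂) + E₂ * ((T₁ + T₂) * T₂)) := by
    rw [mul_zero, add_zero, neg_mul, mul_neg, ← mul_assoc, h.entryC₀_sigma, add_mul,
      smul_mul_assoc, mul_assoc E₂]
  have h4 : (E₁ * (T₁ + T₂) - (E₁ - E₂) * T₂) * (-(s * (T₁ + T₂)))
      = -((2 * x) • (s * (T₁ + T₂)) - (T₁ + T₂)) + (E₁ - E₂) * (s * (T₁ + T₂)) * T₂ := by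
    rw [mul_neg, sub_mul, ← mul_assoc (E₁ * (T₁ + T₂)), h.mul_s_eq, mul_assoc _ T₂, h2, sub_mul,
      smul_mul_assoc, one_mul, ← mul_assoc (E₁ - E₂)]
    abel
  rw [h3, h4]
  simp only [zero_mul, mul_zero, sub_zero, add_zero, zero_add]
  module

theorem gen_entryB₀ (h : DigammaPair x E₁ E₂ T₁ T₂ Φ₁ Φ₂ s t) :
    ⁅Φ₁ - Φ₂, entryB₀ x E₁ E₂ T₁ T₂⁆ = (-2 : ℂ) • entryB₁ E₁ E₂ T₁ T₂ := by
  rw [sub_bracket, h.Φ₁_entryB₀, ← h.entryB₀_swap, h.swap.Φ₁_entryB₀, entryB₁]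
  simp only [mul_add, add_mul, sub_mul, h.tt]
  module

theorem Φ₁_entryB₁ (h : DigammaPair x E₁ E₂ T₁ T₂ Φ₁ Φ₂ s t) :
    ⁅Φ₁, entryB₁ E₁ E₂ T₁ T₂⁆
      = (1 / 2 : ℂ) • ((2 * x) • (s * (T₁ + T₂)) - (T₁ + T₂))
        + (E₁ - E₂) * (s * (T₁ + T₂)) * T₂ := by
  -- Rewritten in E₁ - E₂, N₁, P and T₂: of these, only P fails to commute with Φ₁.
  have h1 : entryB₁ E₁ E₂ T₁ T₂ = (1 / 2 : ℂ) • ((E₁ - E₂) * (T₂ * T₂))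
      - (1 / 2 : ℂ) • (E₁ * (T₁ + T₂) * (T₁ + T₂)) + E₁ * (T₁ + T₂) * T₂
      - (E₁ - E₂) * ((T₁ + T₂) * T₂) := by
    rw [entryB₁]
    simp only [mul_add, add_mul, sub_mul, h.tt, mul_assoc]
    module
  rw [h1]
  simp only [bracket_sub _ _ (_ * _), bracket_add _ _ (_ * _), bracket_sub _ _ (_ • _), bracket_smul,
    bracket_mul _ (E₁ - E₂), h.Φ₁_diff, bracket_mul _ T₂, h.Φ₁T₂, bracket_mul _ (E₁ * (T₁ + T₂)),
    h.Φ₁_number, bracket_mul _ (T₁ + T₂), h.Φ₁_sum]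
  rw [mul_neg, ← mul_assoc (E₁ * (T₁ + T₂)) s, h.mul_s_eq, sub_mul (_ • s), smul_mul_assoc, one_mul]
  simp only [zero_mul, mul_zero, add_zero, zero_add, neg_mul, mul_neg, mul_assoc]
  module

theorem entryB₁_swap (h : DigammaPair x E₁ E₂ T₁ T₂ Φ₁ Φ₂ s t) :
    entryB₁ E₂ E₁ T₂ T₁ = -entryB₁ E₁ E₂ T₁ T₂ := by
  rw [entryB₁, entryB₁, h.tt, sub_mul, sub_mul]; module

theorem gen_entryB₁ (h : DigammaPair x E₁ E₂ T₁ T₂ Φ₁ Φ₂ s t) :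
    ⁅Φ₁ - Φ₂, entryB₁ E₁ E₂ T₁ T₂⁆
      = x • (s * (T₁ + T₂) + t * (T₁ + T₂)) - (T₁ + T₂)
        + (E₁ - E₂) * (s * (T₁ + T₂)) * T₂ - (E₁ - E₂) * (t * (T₁ + T₂)) * T₁ := by
  have h1 : ⁅Φ₂, entryB₁ E₁ E₂ T₁ T₂⁆ = -⁅Φ₂, entryB₁ E₂ E₁ T₂ T₁⁆ := by
    rw [h.entryB₁_swap, bracket_neg, neg_neg]
  rw [sub_bracket, h1, h.Φ₁_entryB₁, h.swap.Φ₁_entryB₁, add_comm T₂ T₁]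
  simp only [sub_mul]
  module

theorem gen_sum (h : DigammaPair x E₁ E₂ T₁ T₂ Φ₁ Φ₂ s t) :
    ⁅Φ₁ - Φ₂, T₁ + T₂⁆ = -(s * (T₁ + T₂) - t * (T₁ + T₂)) := by
  rw [bracket_add, h.gen_T₁, h.gen_T₂]; abel

/-- Three equal contributions σ - τ: one from -P, and one from each of the two terms (E₁ - E₂)σT₂
and -(E₁ - E₂)τT₁, by the resolvent identity. -/
theorem gen_gen_entryB₁ (h : DigammaPair x E₁ E₂ T₁ T₂ Φ₁ Φ₂ s t) :
    ⁅Φ₁ - Φ₂, ⁅Φ₁ - Φ₂, entryB₁ E₁ E₂ T₁ T₂⁆⁆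
      = (3 : ℂ) • (s * (T₁ + T₂) - t * (T₁ + T₂)) := by
  rw [h.gen_entryB₁, bracket_sub, bracket_add, bracket_sub, h.gen_sum, bracket_smul, bracket_add,
    h.gen_sigma, h.gen_tau, bracket_mul _ _ T₂, bracket_mul _ _ T₁, h.gen_diff_sigma,
    bracket_mul _ (E₁ - E₂), h.gen_diff, h.gen_tau, h.gen_T₁, h.gen_T₂, mul_neg, h.sigma_sub_tau,
    h.sigma_sub_tau']
  simp only [zero_mul, mul_zero, add_zero, zero_add, smul_zero]
  module

end DigammaPair

end Entries

/-! ### Conjugation by an exponential with terminating iterated commutators -/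

section Exponential

/-- `R = exp X` in the weak sense: the exponential series converges after applying it to any
vector and pairing with any linear functional. -/
def IsWeakExp {V : Type*} [AddCommGroup V] [Module ℂ V] (R X : Module.End ℂ V) : Prop :=
  ∀ (φ : Module.Dual ℂ V) (v : V),
    HasSum (fun j : ℕ => ((j.factorial : ℂ))⁻¹ * φ ((X ^ j) v)) (φ (R v))

/-- Left multiplication by X is the sum of ad X and right multiplication by X. These two commute, so
the binomial theorem applies. -/
theorem pow_mul_eq_sum_antidiagonal {A : Type*} [Ring A] {X : A} {Z : ℕ → A}
    (hZ : ∀ i, ⁅X, Z i⁆ = Z (i + 1)) (n : ℕ) :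
    X ^ n * Z 0 = ∑ ij ∈ Finset.HasAntidiagonal.antidiagonal n, n.choose ij.1 • (Z ij.1 * X ^ ij.2) := by
  let L : Module.End ℤ A := LinearMap.mulLeft ℤ X
  let Q : Module.End ℤ A := LinearMap.mulRight ℤ X
  have hc : Commute (L - Q) Q := by
    refine LinearMap.ext fun a => ?_
    simp only [L, Q, Module.End.mul_apply, LinearMap.sub_apply, LinearMap.mulLeft_apply,
      LinearMap.mulRight_apply]
    noncomm_ring
  have had : ∀ i j, ((L - Q) ^ i) (Z j) = Z (j + i) := by
    intro i
    induction i with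
    | zero => intro j; rfl
    | succ i ih =>
      intro j
      rw [pow_succ, Module.End.mul_apply]
      have : (L - Q) (Z j) = Z (j + 1) := hZ j
      rw [this, ih, Nat.add_right_comm, Nat.add_assoc]
  have hL : ∀ k (a : A), (L ^ k) a = X ^ k * a := by
    intro k a; rw [LinearMap.pow_mulLeft]; rfl
  have hQ : ∀ k (a : A), (Q ^ k) a = a * X ^ k := by
    intro k a; rw [LinearMap.pow_mulRight]; rfl
  have := hc.add_pow' n
  rw [sub_add_cancel] at this
  rw [← hL, this, LinearMap.sum_apply]
  refine Finset.sum_congr rfl fun ij _ => ?_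
  rw [(hc.pow_pow ij.1 ij.2).eq, LinearMap.smul_apply, Module.End.mul_apply, had, hQ, zero_add]

variable {V : Type*} [AddCommGroup V] [Module ℂ V]

theorem hasSum_shift {f : ℕ → ℂ} {a : ℂ} (hf : HasSum f a) (i : ℕ) :
    HasSum (fun n => if i ≤ n then f (n - i) else 0) a := by
  have hinj : Function.Injective fun n : ℕ => n + i := add_left_injective i
  have h0 : ∀ n, n ∉ Set.range (fun n : ℕ => n + i) →
      (if i ≤ n then f (n - i) else 0) = 0 := by
    intro n hn
    rw [if_neg]
    exact fun h => hn ⟨n - i, Nat.sub_add_cancel h⟩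
  rw [← hinj.hasSum_iff h0]
  convert hf using 2 with n
  simp [Function.comp_def]

/-- After the commutator expansion, the series for R Z₀ is a sum of finitely many shifted copies of
the series for R, paired with the functionals φ ∘ Zᵢ. No rearrangement of a double series is needed.
-/
theorem IsWeakExp.mul_eq {R X : Module.End ℂ V} (hR : IsWeakExp R X) {Z : ℕ → Module.End ℂ V}
    (hZ : ∀ i, ⁅X, Z i⁆ = Z (i + 1)) {m : ℕ} (hm : ∀ i, m ≤ i → Z i = 0) :
    R * Z 0 = (∑ i ∈ Finset.range m, ((i.factorial : ℂ))⁻¹ • Z i) * R := by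
  refine LinearMap.ext fun v => ?_
  rw [← sub_eq_zero, ← Module.forall_dual_apply_eq_zero_iff ℂ]
  intro φ
  rw [map_sub, sub_eq_zero]
  have h1 := hR φ (Z 0 v)
  have h2 : HasSum (fun n : ℕ => ∑ i ∈ Finset.range m, if i ≤ n then
      ((i.factorial : ℂ))⁻¹ * ((((n - i).factorial : ℂ))⁻¹ * φ (Z i ((X ^ (n - i)) v))) else 0)
      (∑ i ∈ Finset.range m, ((i.factorial : ℂ))⁻¹ * φ (Z i (R v))) :=
    hasSum_sum fun i _ => hasSum_shift
      (f := fun n => ((i.factorial : ℂ))⁻¹ * (((n.factorial : ℂ))⁻¹ * φ (Z i ((X ^ n) v))))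
      ((hR (φ ∘ₗ Z i) v).mul_left _) i
  have h3 : (fun j : ℕ => ((j.factorial : ℂ))⁻¹ * φ ((X ^ j) (Z 0 v))) = fun n : ℕ =>
      ∑ i ∈ Finset.range m, if i ≤ n then
      ((i.factorial : ℂ))⁻¹ * ((((n - i).factorial : ℂ))⁻¹ * φ (Z i ((X ^ (n - i)) v))) else 0 := by
    funext n
    have hp := congrArg (fun B : Module.End ℂ V => φ (B v)) (pow_mul_eq_sum_antidiagonal hZ n)
    simp only [Module.End.mul_apply, LinearMap.sum_apply, map_sum, LinearMap.smul_apply,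
      map_nsmul] at hp
    rw [hp, Finset.mul_sum, Finset.Nat.sum_antidiagonal_eq_sum_range_succ
      (fun i j => ((n.factorial : ℂ))⁻¹ * n.choose i • φ ((Z i) ((X ^ j) v)))]
    rw [← Finset.sum_filter]
    refine (Finset.sum_subset (s₁ := (Finset.range m).filter (· ≤ n)) ?_ ?_).symm.trans ?_
    · intro i hi
      simp only [Finset.mem_filter, Finset.mem_range] at hi ⊢
      omega
    · intro i hi hi'
      simp only [Finset.mem_filter, Finset.mem_range] at hi hi'
      rw [hm i (by omega)]; simp
    · refine Finset.sum_congr rfl fun i hi => ?_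
      simp only [Finset.mem_filter, Finset.mem_range] at hi
      rw [nsmul_eq_mul, Nat.cast_choose ℂ hi.2]
      have := Nat.cast_ne_zero (R := ℂ).2 n.factorial_ne_zero
      field_simp
  rw [h3] at h1
  rw [Module.End.mul_apply, h1.unique h2]
  simp [LinearMap.sum_apply, Module.End.mul_apply]

/-- If the iterated commutators of `X` with `Z₀` end with `Z₃`, conjugation by `exp X` acts on `Z₀`
by a finite sum. -/
theorem IsWeakExp.mul_eq_of_bracket {R X Z₀ Z₁ Z₂ Z₃ : Module.End ℂ V} (hR : IsWeakExp R X)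
    (h₀ : ⁅X, Z₀⁆ = Z₁) (h₁ : ⁅X, Z₁⁆ = Z₂) (h₂ : ⁅X, Z₂⁆ = Z₃) (h₃ : ⁅X, Z₃⁆ = 0) :
    R * Z₀ = (Z₀ + Z₁ + (1 / 2 : ℂ) • Z₂ + (1 / 6 : ℂ) • Z₃) * R := by
  let Z : ℕ → Module.End ℂ V := fun i =>
    match i with
    | 0 => Z₀
    | 1 => Z₁
    | 2 => Z₂
    | 3 => Z₃
    | _ + 4 => 0
  have hZ : ∀ i, ⁅X, Z i⁆ = Z (i + 1) := by
    intro i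
    match i with
    | 0 => exact h₀
    | 1 => exact h₁
    | 2 => exact h₂
    | 3 => exact h₃
    | _ + 4 => exact bracket_zero _
  have := hR.mul_eq hZ (m := 4) (by
    intro i hi
    obtain ⟨k, rfl⟩ := Nat.exists_eq_add_of_le' hi
    rfl)
  rw [show Z₀ = Z 0 from rfl, this]
  simp only [Finset.sum_range_succ, Finset.sum_range_zero, Nat.factorial, Z]
  norm_num

namespace DigammaPair

variable {x y : ℂ} {E₁ E₂ T₁ T₂ Φ₁ Φ₂ s t R : Module.End ℂ V}

theorem smul_bracket (c : ℂ) (a b : Module.End ℂ V) : ⁅c • a, b⁆ = c • ⁅a, b⁆ := by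
  simp only [Ring.lie_def, mul_smul_comm, smul_mul_assoc, smul_sub]

theorem exp_entryC (h : DigammaPair x E₁ E₂ T₁ T₂ Φ₁ Φ₂ s t) (hR : IsWeakExp R (y • (Φ₁ - Φ₂))) :
    R * (entryC₀ x E₁ E₂ T₁ T₂ - (y / 2) • (E₁ - E₂))
      = (entryC₀ x E₁ E₂ T₁ T₂ + (y / 2) • (E₁ - E₂)) * R := by
  rw [hR.mul_eq_of_bracket (Z₁ := y • (E₁ - E₂)) (Z₂ := 0) (Z₃ := 0)]
  · congr 1; module
  · rw [smul_bracket, bracket_sub, bracket_smul, h.gen_entryC₀, h.gen_diff, smul_zero, sub_zero]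
  · rw [smul_bracket, bracket_smul, h.gen_diff, smul_zero, smul_zero]
  · exact bracket_zero _
  · exact bracket_zero _

theorem exp_entryA (h : DigammaPair x E₁ E₂ T₁ T₂ Φ₁ Φ₂ s t) (hR : IsWeakExp R (y • (Φ₁ - Φ₂))) :
    R * (entryA₀ x E₁ E₂ T₁ T₂ + y • entryA₁ E₁ E₂ T₁ T₂ - (y ^ 2 / 4) • 1)
      = (entryA₀ x E₁ E₂ T₁ T₂ - y • entryA₁ E₁ E₂ T₁ T₂ - (y ^ 2 / 4) • 1) * R := by
  rw [hR.mul_eq_of_bracket (Z₁ := (-2 * y) • entryA₁ E₁ E₂ T₁ T₂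
      - y ^ 2 • ((E₁ - E₂) * (s * (T₁ + T₂))))
    (Z₂ := (2 * y ^ 2) • ((E₁ - E₂) * (s * (T₁ + T₂)))) (Z₃ := 0)]
  · congr 1; module
  · rw [smul_bracket, bracket_sub, bracket_add, bracket_smul, bracket_smul, bracket_one,
      h.gen_entryA₀, h.gen_entryA₁]
    module
  · rw [smul_bracket, bracket_sub, bracket_smul, bracket_smul, h.gen_diff_sigma, h.gen_entryA₁]
    module
  · rw [smul_bracket, bracket_smul, h.gen_diff_sigma, smul_zero, smul_zero]
  · exact bracket_zero _

/-- Beyond the sign change of yB₁, the order y² contributions of [H, B₁] cancel, and at order y³ the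
coefficients of σ - τ are -1 from B₀, 3/2 from B₁ and -1/2 from P, with sum zero. -/
theorem exp_entryB (h : DigammaPair x E₁ E₂ T₁ T₂ Φ₁ Φ₂ s t) (hR : IsWeakExp R (y • (Φ₁ - Φ₂))) :
    R * (entryB₀ x E₁ E₂ T₁ T₂ + y • entryB₁ E₁ E₂ T₁ T₂ + (y ^ 2 / 2) • (T₁ + T₂))
      = (entryB₀ x E₁ E₂ T₁ T₂ - y • entryB₁ E₁ E₂ T₁ T₂ + (y ^ 2 / 2) • (T₁ + T₂)) * R := by
  have hW : ⁅Φ₁ - Φ₂, s * (T₁ + T₂) - t * (T₁ + T₂)⁆ = 0 := by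
    rw [bracket_sub, h.gen_sigma, h.gen_tau, sub_zero]
  rw [hR.mul_eq_of_bracket
    (Z₁ := (-2 * y) • entryB₁ E₁ E₂ T₁ T₂ + y ^ 2 • ⁅Φ₁ - Φ₂, entryB₁ E₁ E₂ T₁ T₂⁆
      - (y ^ 3 / 2) • (s * (T₁ + T₂) - t * (T₁ + T₂)))
    (Z₂ := (-2 * y ^ 2) • ⁅Φ₁ - Φ₂, entryB₁ E₁ E₂ T₁ T₂⁆
      + (3 * y ^ 3) • (s * (T₁ + T₂) - t * (T₁ + T₂)))
    (Z₃ := (-6 * y ^ 3) • (s * (T₁ + T₂) - t * (T₁ + T₂)))]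
  · congr 1; module
  · rw [smul_bracket, bracket_add, bracket_add, bracket_smul, bracket_smul, h.gen_entryB₀,
      h.gen_sum]
    module
  · rw [smul_bracket, bracket_sub, bracket_add, bracket_smul, bracket_smul, bracket_smul, hW,
      h.gen_gen_entryB₁]
    module
  · rw [smul_bracket, bracket_add, bracket_smul, bracket_smul, hW, h.gen_gen_entryB₁]
    module
  · rw [smul_bracket, bracket_smul, hW, smul_zero, smul_zero]

/-- The lower-right entry is the upper-left one with the auxiliary spaces exchanged and y negated;
yH is invariant under this double change. -/
theorem exp_entryD (h : DigammaPair x E₁ E₂ T₁ T₂ Φ₁ Φ₂ s t) (hR : IsWeakExp R (y • (Φ₁ - Φ₂))) :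
    R * (entryA₀ x E₂ E₁ T₂ T₁ - y • entryA₁ E₂ E₁ T₂ T₁ - (y ^ 2 / 4) • 1)
      = (entryA₀ x E₂ E₁ T₂ T₁ + y • entryA₁ E₂ E₁ T₂ T₁ - (y ^ 2 / 4) • 1) * R := by
  have hR' : IsWeakExp R ((-y) • (Φ₂ - Φ₁)) := by
    rwa [neg_smul, ← smul_neg, neg_sub]
  have := h.swap.exp_entryA hR'
  simpa only [neg_smul, ← sub_eq_add_neg, sub_neg_eq_add, neg_sq] using this

end DigammaPair

end Exponential

/-! ### Ladder operators on one and two auxiliary spaces -/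

instance : AddCommGroup Aux := Module.addCommMonoidToAddCommGroup ℂ

instance : AddCommGroup (Aux ⊗[ℂ] Aux) := Module.addCommMonoidToAddCommGroup ℂ

/-- The lowering operator `∑ₖ |k⟩⟨k+1|`. -/
def opLower : Module.End ℂ Aux :=
  Finsupp.linearCombination ℂ fun j =>
    match j with
    | 0 => 0
    | k + 1 => ket k

/-- The diagonal operator `∑ₖ h_k |k⟩⟨k|`. -/
def opDiag (h : ℕ → ℂ) : Module.End ℂ Aux :=
  Finsupp.linearCombination ℂ fun k => h k • ket k

theorem opZero_ket (p : ℂ) (k : ℕ) : opZero p (ket k) = ampZero p k • ket k := by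
  simp [opZero, ket]

theorem opPlus_ket_zero (p : ℂ) : opPlus p (ket 0) = 0 := by
  simp [opPlus, ket]

theorem opPlus_ket_succ (p : ℂ) (k : ℕ) : opPlus p (ket (k + 1)) = ampPlus p k • ket k := by
  simp [opPlus, ket]

theorem opMinus_ket (k : ℕ) : opMinus (ket k) = ((k : ℂ) + 1) • ket (k + 1) := by
  simp [opMinus, ket, ampMinus]

theorem opLower_ket_zero : opLower (ket 0) = 0 := by
  simp [opLower, ket]

theorem opLower_ket_succ (k : ℕ) : opLower (ket (k + 1)) = ket k := by
  simp [opLower, ket]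

theorem opDiag_ket (h : ℕ → ℂ) (k : ℕ) : opDiag h (ket k) = h k • ket k := by
  simp [opDiag, ket]

theorem aux_ext {W : Type*} [AddCommMonoid W] [Module ℂ W] {f g : Aux →ₗ[ℂ] W}
    (h : ∀ k, f (ket k) = g (ket k)) : f = g :=
  Finsupp.lhom_ext' fun k => LinearMap.ext_ring (h k)

/-- With |k⟩ = zᵏ/k!, `opMinus` is multiplication by z and `opLower` is d/dz. -/
theorem opLower_mul_opMinus : opLower * opMinus = opMinus * opLower + 1 := by
  refine aux_ext fun k => ?_
  cases k with
  | zero => simp [opMinus_ket, opLower_ket_succ, opLower_ket_zero]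
  | succ k => simp [opMinus_ket, opLower_ket_succ, add_smul]

theorem opZero_eq (p : ℂ) : opZero p = p • 1 - opMinus * opLower := by
  refine aux_ext fun k => ?_
  cases k with
  | zero => simp [opZero_ket, opLower_ket_zero, ampZero]
  | succ k => simp [opZero_ket, opLower_ket_succ, opMinus_ket, ampZero, sub_smul]

theorem opPlus_eq (p : ℂ) : opPlus p = (opMinus * opLower - (2 * p) • 1) * opLower := by
  refine aux_ext fun k => ?_
  match k with
  | 0 => simp [opPlus_ket_zero, opLower_ket_zero]
  | 1 =>
    simp only [opPlus_ket_succ, opLower_ket_succ, opLower_ket_zero, ampPlus, Module.End.mul_apply,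
      LinearMap.sub_apply, LinearMap.smul_apply, Module.End.one_apply, map_zero, Nat.cast_zero,
      sub_smul, zero_smul]
  | k + 2 => simp [opPlus_ket_succ, opLower_ket_succ, opMinus_ket, ampPlus, sub_smul]

theorem opDiag_mul (g h : ℕ → ℂ) : opDiag g * opDiag h = opDiag fun k => g k * h k := by
  refine aux_ext fun k => ?_
  simp [opDiag_ket, smul_smul, mul_comm]

theorem opDiag_eq_number (c : ℂ) : opDiag (fun k => c - k) = c • 1 - opMinus * opLower :=
  (opZero_eq c ▸ rfl : opDiag (fun k => c - k) = _)

theorem opDiag_mul_opMinus (h : ℕ → ℂ) :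
    opDiag h * opMinus = opMinus * opDiag fun k => h (k + 1) := by
  refine aux_ext fun k => ?_
  simp [opDiag_ket, opMinus_ket, smul_smul, mul_comm]

theorem opLower_mul_opDiag (h : ℕ → ℂ) :
    opLower * opDiag h = (opDiag fun k => h (k + 1)) * opLower := by
  refine aux_ext fun k => ?_
  cases k <;> simp [opDiag_ket, opLower_ket_succ, opLower_ket_zero]

theorem opDiag_sub (g h : ℕ → ℂ) : opDiag g - opDiag h = opDiag fun k => g k - h k := by
  refine aux_ext fun k => ?_
  simp [opDiag_ket, sub_smul]

theorem opDiag_one : opDiag (fun _ => 1) = 1 := by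
  refine aux_ext fun k => ?_
  simp [opDiag_ket]

/-- `A ↦ A ⊗ 1`. -/
def onFst : Module.End ℂ Aux →ₐ[ℂ] Module.End ℂ (Aux ⊗[ℂ] Aux) := Module.End.rTensorAlgHom ℂ Aux Aux

/-- `A ↦ 1 ⊗ A`. -/
def onSnd : Module.End ℂ Aux →ₐ[ℂ] Module.End ℂ (Aux ⊗[ℂ] Aux) := Module.End.lTensorAlgHom ℂ Aux Aux

theorem onFst_tmul (A : Module.End ℂ Aux) (u v : Aux) : onFst A (u ⊗ₜ v) = A u ⊗ₜ v := rfl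

theorem onSnd_tmul (A : Module.End ℂ Aux) (u v : Aux) : onSnd A (u ⊗ₜ v) = u ⊗ₜ A v := rfl

theorem commute_onFst_onSnd (A B : Module.End ℂ Aux) : Commute (onFst A) (onSnd B) :=
  TensorProduct.ext' fun _ _ => rfl

theorem ketBasis_apply (k l : ℕ) : ketBasis (k, l) = ket k ⊗ₜ ket l := by
  simp [ketBasis, ket]

theorem two_aux_ext {W : Type*} [AddCommMonoid W] [Module ℂ W] {f g : Aux ⊗[ℂ] Aux →ₗ[ℂ] W}
    (h : ∀ k l, f (ketBasis (k, l)) = g (ketBasis (k, l))) : f = g :=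
  ketBasis.ext fun b => h b.1 b.2

/-! ### Functions of the triangular number operator -/

/-- The operator `|l, j⟩ ↦ (1/j!) F^j |l, 0⟩`. -/
def substitute (F : Module.End ℂ (Aux ⊗[ℂ] Aux)) : Module.End ℂ (Aux ⊗[ℂ] Aux) :=
  ketBasis.constr ℂ fun b => ((b.2.factorial : ℂ))⁻¹ • (F ^ b.2) (ketBasis (b.1, 0))

theorem substitute_ket (F : Module.End ℂ (Aux ⊗[ℂ] Aux)) (l j : ℕ) :
    substitute F (ketBasis (l, j)) = ((j.factorial : ℂ))⁻¹ • (F ^ j) (ketBasis (l, 0)) := by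
  rw [substitute, Module.Basis.constr_basis]

theorem substitute_ket_zero (F : Module.End ℂ (Aux ⊗[ℂ] Aux)) (l : ℕ) :
    substitute F (ketBasis (l, 0)) = ketBasis (l, 0) := by
  simp [substitute_ket]

theorem onFst_opMinus_ket (l j : ℕ) :
    onFst opMinus (ketBasis (l, j)) = ((l : ℂ) + 1) • ketBasis (l + 1, j) := by
  simp only [ketBasis_apply, onFst_tmul, opMinus_ket, TensorProduct.smul_tmul']

theorem onSnd_opMinus_ket (l j : ℕ) :
    onSnd opMinus (ketBasis (l, j)) = ((j : ℂ) + 1) • ketBasis (l, j + 1) := by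
  simp only [ketBasis_apply, onSnd_tmul, opMinus_ket, TensorProduct.tmul_smul]

theorem onFst_opDiag_ket (h : ℕ → ℂ) (l j : ℕ) :
    onFst (opDiag h) (ketBasis (l, j)) = h l • ketBasis (l, j) := by
  simp only [ketBasis_apply, onFst_tmul, opDiag_ket, TensorProduct.smul_tmul']

theorem onFst_opLower_ket_zero (j : ℕ) : onFst opLower (ketBasis (0, j)) = 0 := by
  simp only [ketBasis_apply, onFst_tmul, opLower_ket_zero, TensorProduct.zero_tmul]

theorem onFst_opLower_ket_succ (l j : ℕ) :
    onFst opLower (ketBasis (l + 1, j)) = ketBasis (l, j) := by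
  simp only [ketBasis_apply, onFst_tmul, opLower_ket_succ]

theorem onSnd_opLower_ket_zero (l : ℕ) : onSnd opLower (ketBasis (l, 0)) = 0 := by
  simp only [ketBasis_apply, onSnd_tmul, opLower_ket_zero, TensorProduct.tmul_zero]

theorem onSnd_opLower_ket_succ (l j : ℕ) :
    onSnd opLower (ketBasis (l, j + 1)) = ketBasis (l, j) := by
  simp only [ketBasis_apply, onSnd_tmul, opLower_ket_succ]

variable {F : Module.End ℂ (Aux ⊗[ℂ] Aux)}

/-- In the polynomial model |l, j⟩ = z₁ˡz₂ʲ/(l! j!), `substitute F` replaces z₂ by F when F is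
multiplication by a polynomial. The intertwining lemmas below are then the rules for a change of
variables. -/
theorem substitute_mul_onFst_opMinus (hF : Commute (onFst opMinus) F) :
    substitute F * onFst opMinus = onFst opMinus * substitute F := by
  refine two_aux_ext fun l j => ?_
  have := LinearMap.congr_fun (hF.pow_right j).eq (ketBasis (l, 0))
  simp only [Module.End.mul_apply] at this
  simp only [Module.End.mul_apply, onFst_opMinus_ket, map_smul, substitute_ket, this]
  rw [smul_comm]

theorem factorial_succ_smul {W : Type*} [AddCommMonoid W] [Module ℂ W] (j : ℕ) (w : W) :
    ((j : ℂ) + 1) • (((j + 1).factorial : ℂ))⁻¹ • w = ((j.factorial : ℂ))⁻¹ • w := by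
  rw [smul_smul]
  congr 1
  have h1 : (j.factorial : ℂ) ≠ 0 := Nat.cast_ne_zero.2 j.factorial_ne_zero
  have h2 : (j : ℂ) + 1 ≠ 0 := Nat.cast_add_one_ne_zero j
  rw [Nat.factorial_succ]
  push_cast
  field_simp

theorem substitute_mul_onSnd_opMinus (F : Module.End ℂ (Aux ⊗[ℂ] Aux)) :
    substitute F * onSnd opMinus = F * substitute F := by
  refine two_aux_ext fun l j => ?_
  simp only [Module.End.mul_apply, onSnd_opMinus_ket, map_smul, substitute_ket,
    factorial_succ_smul, pow_succ']

theorem substitute_mul_onFst_opLower {G : Module.End ℂ (Aux ⊗[ℂ] Aux)} (hG : Commute G F)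
    (h0 : ∀ l, G (ketBasis (l, 0)) = onFst opLower (ketBasis (l, 0))) :
    substitute F * onFst opLower = G * substitute F := by
  refine two_aux_ext fun l j => ?_
  have := LinearMap.congr_fun (hG.pow_right j).eq (ketBasis (l, 0))
  simp only [Module.End.mul_apply, h0] at this
  simp only [Module.End.mul_apply, map_smul, substitute_ket, this]
  cases l with
  | zero => simp [onFst_opLower_ket_zero]
  | succ l => simp only [onFst_opLower_ket_succ, substitute_ket]

theorem substitute_mul_onSnd_opLower (hF : onSnd opLower * F = F * onSnd opLower + 1) :
    substitute F * onSnd opLower = onSnd opLower * substitute F := by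
  have hpow : ∀ j : ℕ, onSnd opLower * F ^ (j + 1)
      = F ^ (j + 1) * onSnd opLower + ((j : ℂ) + 1) • F ^ j := by
    intro j
    induction j with
    | zero => simp [hF]
    | succ j ih =>
      rw [pow_succ, ← mul_assoc, ih, add_mul, mul_assoc, hF, mul_add, mul_one, smul_mul_assoc,
        ← pow_succ, mul_assoc]
      push_cast
      module
  refine two_aux_ext fun l j => ?_
  cases j with
  | zero => simp [substitute_ket_zero, onSnd_opLower_ket_zero]
  | succ j =>
    have := LinearMap.congr_fun (hpow j) (ketBasis (l, 0))
    simp only [Module.End.mul_apply, LinearMap.add_apply, LinearMap.smul_apply,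
      onSnd_opLower_ket_zero, map_zero, zero_add] at this
    simp only [Module.End.mul_apply, onSnd_opLower_ket_succ, map_smul, substitute_ket, this]
    rw [smul_comm, factorial_succ_smul]

theorem onSnd_opMinus_pow_ket (l j : ℕ) :
    ((j.factorial : ℂ))⁻¹ • (onSnd opMinus ^ j) (ketBasis (l, 0)) = ketBasis (l, j) := by
  have : substitute (onSnd opMinus) = 1 := by
    refine two_aux_ext fun l j => ?_
    induction j with
    | zero => simp [substitute_ket_zero]
    | succ j ih =>
      have h := LinearMap.congr_fun (substitute_mul_onSnd_opMinus (onSnd opMinus)) (ketBasis (l, j))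
      rw [Module.End.mul_apply, Module.End.mul_apply, ih, Module.End.one_apply,
        onSnd_opMinus_ket, map_smul] at h
      exact smul_right_injective _ (Nat.cast_add_one_ne_zero j) h
  rw [← substitute_ket, this]; rfl

/-- The hypothesis carries Gʲ|l,0⟩ to E₂ʲ|l,0⟩ = j! |l,j⟩, so the two substitutions undo each other.
-/
theorem substitute_mul_substitute {F G : Module.End ℂ (Aux ⊗[ℂ] Aux)}
    (h : substitute F * G = onSnd opMinus * substitute F) : substitute F * substitute G = 1 := by
  refine two_aux_ext fun l j => ?_
  have hp : substitute F * G ^ j = onSnd opMinus ^ j * substitute F :=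
    (SemiconjBy.pow_right (show SemiconjBy (substitute F) G (onSnd opMinus) from h) j)
  have := LinearMap.congr_fun hp (ketBasis (l, 0))
  simp only [Module.End.mul_apply, substitute_ket_zero] at this
  rw [Module.End.mul_apply, substitute_ket, map_smul, this, onSnd_opMinus_pow_ket]; rfl

/-- The automorphism of the two-mode Weyl algebra with `E₁ ↦ E₁`, `E₂ ↦ E₂ - E₁`, `T₁ ↦ T₁ + T₂`,
`T₂ ↦ T₂`. -/
def shear (X : Module.End ℂ (Aux ⊗[ℂ] Aux)) : Module.End ℂ (Aux ⊗[ℂ] Aux) :=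
  substitute (onSnd opMinus - onFst opMinus) * X * substitute (onFst opMinus + onSnd opMinus)

theorem commute_opMinus : Commute (onFst opMinus) (onSnd opMinus) :=
  commute_onFst_onSnd _ _

theorem substitute_sub_mul_substitute_add :
    substitute (onSnd opMinus - onFst opMinus) * substitute (onFst opMinus + onSnd opMinus) = 1 := by
  apply substitute_mul_substitute
  rw [mul_add, substitute_mul_onFst_opMinus (commute_opMinus.sub_right (Commute.refl _)),
    substitute_mul_onSnd_opMinus, ← add_mul]
  congr 1
  abel

theorem substitute_add_mul_substitute_sub :
    substitute (onFst opMinus + onSnd opMinus) * substitute (onSnd opMinus - onFst opMinus) = 1 := by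
  apply substitute_mul_substitute
  rw [mul_sub, substitute_mul_onFst_opMinus ((Commute.refl _).add_right commute_opMinus),
    substitute_mul_onSnd_opMinus, ← sub_mul]
  congr 1
  abel

theorem shear_mul (X Y : Module.End ℂ (Aux ⊗[ℂ] Aux)) : shear X * shear Y = shear (X * Y) := by
  simp only [shear]
  rw [← mul_assoc, ← mul_assoc, mul_assoc (_ * X), substitute_add_mul_substitute_sub, mul_one,
    mul_assoc _ X]

theorem shear_sub (X Y : Module.End ℂ (Aux ⊗[ℂ] Aux)) : shear X - shear Y = shear (X - Y) := by
  simp only [shear, mul_sub, sub_mul]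

theorem shear_neg (X : Module.End ℂ (Aux ⊗[ℂ] Aux)) : shear (-X) = -shear X :=
  (congrArg (· * _) (mul_neg _ X)).trans (neg_mul _ _)

theorem shear_one : shear 1 = 1 := by
  rw [shear, mul_one, substitute_sub_mul_substitute_add]

theorem shear_eq_of_mul_eq {X Y : Module.End ℂ (Aux ⊗[ℂ] Aux)}
    (h : substitute (onSnd opMinus - onFst opMinus) * X
      = Y * substitute (onSnd opMinus - onFst opMinus)) : shear X = Y := by
  rw [shear, h, mul_assoc, substitute_sub_mul_substitute_add, mul_one]

theorem shear_bracket (X Y : Module.End ℂ (Aux ⊗[ℂ] Aux)) : ⁅shear X, shear Y⁆ = shear ⁅X, Y⁆ := by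
  rw [Ring.lie_def, shear_mul, shear_mul, shear_sub, Ring.lie_def]

theorem onFst_opLower_mul_opMinus :
    onFst opLower * onFst opMinus = onFst opMinus * onFst opLower + 1 := by
  rw [← map_mul, ← map_mul, opLower_mul_opMinus, map_add, map_one]

theorem onSnd_opLower_mul_opMinus :
    onSnd opLower * onSnd opMinus = onSnd opMinus * onSnd opLower + 1 := by
  rw [← map_mul, ← map_mul, opLower_mul_opMinus, map_add, map_one]

theorem shear_onFst_opMinus : shear (onFst opMinus) = onFst opMinus :=
  shear_eq_of_mul_eq
    (substitute_mul_onFst_opMinus (commute_opMinus.sub_right (Commute.refl _)))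

theorem shear_onSnd_opMinus : shear (onSnd opMinus) = onSnd opMinus - onFst opMinus :=
  shear_eq_of_mul_eq (substitute_mul_onSnd_opMinus _)

theorem shear_onSnd_opLower : shear (onSnd opLower) = onSnd opLower := by
  refine shear_eq_of_mul_eq (substitute_mul_onSnd_opLower ?_)
  rw [mul_sub, sub_mul, onSnd_opLower_mul_opMinus,
    (commute_onFst_onSnd opMinus opLower).eq]
  abel

/-- The chain rule for z₂ ↦ z₂ - z₁: T₁ + T₂ annihilates z₂ - z₁ and agrees with T₁ on polynomials
in z₁ alone. -/
theorem shear_onFst_opLower : shear (onFst opLower) = onFst opLower + onSnd opLower := by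
  refine shear_eq_of_mul_eq (substitute_mul_onFst_opLower ?_ ?_)
  · rw [commute_iff_eq]
    simp only [mul_sub, sub_mul, add_mul, mul_add, onSnd_opLower_mul_opMinus,
      onFst_opLower_mul_opMinus, (commute_onFst_onSnd opMinus opLower).eq,
      (commute_onFst_onSnd opLower opMinus).eq]
    abel
  · intro l
    rw [LinearMap.add_apply, onSnd_opLower_ket_zero, add_zero]

/-- The function `h` of the operator `E₁ (T₁ + T₂)`, whose spectrum is `ℕ`. -/
def numberFun (h : ℕ → ℂ) : Module.End ℂ (Aux ⊗[ℂ] Aux) := shear (onFst (opDiag h))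

theorem numberFun_mul (g h : ℕ → ℂ) :
    numberFun g * numberFun h = numberFun fun k => g k * h k := by
  rw [numberFun, numberFun, shear_mul, ← map_mul, opDiag_mul, numberFun]

theorem numberFun_one : numberFun (fun _ => 1) = 1 := by
  rw [numberFun, opDiag_one, map_one, shear_one]

/-- The link from this functional calculus to the resolvent: inverting the function c - k inverts
the operator c - N₁. -/
theorem numberFun_sub_nat (c : ℂ) :
    numberFun (fun k => c - k) = c • 1 - onFst opMinus * (onFst opLower + onSnd opLower) := by
  rw [numberFun, opDiag_eq_number, map_sub, ← shear_sub, map_mul, ← shear_mul,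
    shear_onFst_opMinus, shear_onFst_opLower, map_smul, map_one]
  congr 1
  rw [shear, mul_smul_comm, smul_mul_assoc, mul_one, substitute_sub_mul_substitute_add]

section

variable {h η : ℕ → ℂ}

/-- P lowers N₁ by one, so commuting it past h(N₁) produces the first difference of h. -/
theorem numberFun_bracket_sum (hη : ∀ k, h (k + 1) - h k = η k) :
    ⁅numberFun h, onFst opLower + onSnd opLower⁆
      = -(numberFun η * (onFst opLower + onSnd opLower)) := by
  have h1 : opLower * opDiag h - opDiag h * opLower = opDiag η * opLower := by
    rw [opLower_mul_opDiag, ← sub_mul, opDiag_sub]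
    simp only [hη]
  rw [← shear_onFst_opLower, numberFun, numberFun, shear_bracket, shear_mul, Ring.lie_def,
    ← neg_sub, ← map_mul, ← map_mul, ← map_mul, ← map_sub, h1, shear_neg]

theorem numberFun_bracket_onSnd_opLower : ⁅numberFun h, onSnd opLower⁆ = 0 := by
  rw [← shear_onSnd_opLower, numberFun, shear_bracket, Ring.lie_def,
    (commute_onFst_onSnd _ _).eq, sub_self, shear, mul_zero, zero_mul]

theorem numberFun_bracket_diff : ⁅numberFun h, onSnd opMinus - onFst opMinus⁆ = 0 := by
  rw [← shear_onSnd_opMinus, numberFun, shear_bracket, Ring.lie_def,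
    (commute_onFst_onSnd _ _).eq, sub_self, shear, mul_zero, zero_mul]

theorem numberFun_bracket_onFst_opMinus (hη : ∀ k, h (k + 1) - h k = η k) :
    ⁅numberFun h, onFst opMinus⁆ = onFst opMinus * numberFun η := by
  conv_lhs => rw [← shear_onFst_opMinus]
  conv_rhs => rw [← shear_onFst_opMinus]
  rw [numberFun, numberFun, shear_bracket, shear_mul, Ring.lie_def,
    ← map_mul, ← map_mul, ← map_mul, ← map_sub, opDiag_mul_opMinus, ← mul_sub, opDiag_sub]
  simp only [hη]

end

/-- Exchange of the two auxiliary spaces. -/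
def exchange : Module.End ℂ (Aux ⊗[ℂ] Aux) →ₐ[ℂ] Module.End ℂ (Aux ⊗[ℂ] Aux) :=
  (LinearEquiv.conjAlgEquiv ℂ (TensorProduct.comm ℂ Aux Aux)).toAlgHom

theorem exchange_apply (X : Module.End ℂ (Aux ⊗[ℂ] Aux)) (v : Aux ⊗[ℂ] Aux) :
    exchange X v = TensorProduct.comm ℂ Aux Aux (X (TensorProduct.comm ℂ Aux Aux v)) := rfl

theorem exchange_onFst (A : Module.End ℂ Aux) : exchange (onFst A) = onSnd A :=
  TensorProduct.ext' fun _ _ => rfl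

theorem exchange_onSnd (A : Module.End ℂ Aux) : exchange (onSnd A) = onFst A :=
  TensorProduct.ext' fun _ _ => rfl

theorem exchange_bracket (X Y : Module.End ℂ (Aux ⊗[ℂ] Aux)) :
    ⁅exchange X, exchange Y⁆ = exchange ⁅X, Y⁆ := by
  simp only [Ring.lie_def, map_sub, map_mul]

/-- `h_k = ½ ∑_{m < k} f_m(x)`. -/
def halfPoleSum (x : ℂ) (k : ℕ) : ℂ := ∑ m ∈ Finset.range k, 1 / 2 * pole m x

/-- Here h(k) = ∑_{m<k} 1/(2x - m) is a difference of digamma values, and its first difference is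
the resolvent symbol 1/(2x - k). The hypothesis on x keeps every 2x - k nonzero. -/
theorem digammaPair {x : ℂ} (hx : ∀ m : ℕ, x ≠ (m : ℂ) / 2) :
    DigammaPair x (onFst opMinus) (onSnd opMinus) (onFst opLower) (onSnd opLower)
      (numberFun (halfPoleSum x)) (exchange (numberFun (halfPoleSum x)))
      (numberFun fun k => 1 / 2 * pole k x) (exchange (numberFun fun k => 1 / 2 * pole k x)) := by
  have hη : ∀ k, halfPoleSum x (k + 1) - halfPoleSum x k = 1 / 2 * pole k x := by
    intro k; rw [halfPoleSum, Finset.sum_range_succ, halfPoleSum, add_sub_cancel_left]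
  have hinv : ∀ k : ℕ, (2 * x - k) * (1 / 2 * pole k x) = 1 := by
    intro k
    have : x - (k : ℂ) / 2 ≠ 0 := sub_ne_zero.2 (hx k)
    rw [pole]
    field_simp
    rw [div_self]
    intro h0
    exact this (by linear_combination h0 / 2)
  have hT₂ := numberFun_bracket_onSnd_opLower (h := halfPoleSum x)
  have hT₁ : ⁅numberFun (halfPoleSum x), onFst opLower⁆
      = -((numberFun fun k => 1 / 2 * pole k x) * (onFst opLower + onSnd opLower)) := by
    rw [← numberFun_bracket_sum hη, bracket_add, hT₂, add_zero]
  have hE₁ := numberFun_bracket_onFst_opMinus hη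
  have hE₂ : ⁅numberFun (halfPoleSum x), onSnd opMinus⁆
      = onFst opMinus * numberFun fun k => 1 / 2 * pole k x := by
    have := numberFun_bracket_diff (h := halfPoleSum x)
    rwa [bracket_sub, hE₁, sub_eq_zero] at this
  have hs : ((2 * x) • 1 - onFst opMinus * (onFst opLower + onSnd opLower))
      * (numberFun fun k => 1 / 2 * pole k x) = 1 := by
    rw [← numberFun_sub_nat, numberFun_mul]
    simp only [hinv, numberFun_one]
  have hs' : (numberFun fun k => 1 / 2 * pole k x)
      * ((2 * x) • 1 - onFst opMinus * (onFst opLower + onSnd opLower)) = 1 := by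
    rw [← numberFun_sub_nat, numberFun_mul]
    simp only [mul_comm (1 / 2 * pole _ x), hinv, numberFun_one]
  have hsum : exchange (onFst opLower + onSnd opLower) = onFst opLower + onSnd opLower := by
    rw [map_add, exchange_onFst, exchange_onSnd, add_comm]
  have hnum : exchange ((2 * x) • 1 - onFst opMinus * (onFst opLower + onSnd opLower))
      = (2 * x) • 1 - onSnd opMinus * (onFst opLower + onSnd opLower) := by
    rw [map_sub, map_smul, map_one, map_mul, hsum, exchange_onFst]
  exact
  { ee := commute_opMinus.eq
    tt := (commute_onFst_onSnd _ _).eq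
    te₁₁ := onFst_opLower_mul_opMinus
    te₂₂ := onSnd_opLower_mul_opMinus
    te₁₂ := (commute_onFst_onSnd _ _).eq
    te₂₁ := (commute_onFst_onSnd _ _).eq.symm
    Φ₁T₁ := hT₁
    Φ₁T₂ := hT₂
    Φ₁E₁ := hE₁
    Φ₁E₂ := hE₂
    Φ₂T₁ := by rw [← exchange_onSnd, exchange_bracket, hT₂, map_zero]
    Φ₂T₂ := by
      rw [← exchange_onFst, exchange_bracket, hT₁, map_neg, map_mul, hsum, exchange_onFst]
    Φ₂E₁ := by rw [← exchange_onSnd, exchange_bracket, hE₂, map_mul, exchange_onFst]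
    Φ₂E₂ := by rw [← exchange_onFst, exchange_bracket, hE₁, map_mul]
    mul_s := hs
    s_mul := hs'
    mul_t := by rw [← hnum, ← map_mul, hs, map_one]
    t_mul := by rw [← hnum, ← map_mul, hs', map_one] }

/-! ### Matrix elements of the generator -/

/-- The coefficient of `|l+n, j-n⟩` in `h(E₁ (T₁ + T₂)) |l, j⟩`. -/
def newtonCoeff (h : ℕ → ℂ) (l n : ℕ) : ℂ := ((l + n).choose n : ℂ) * (fwdDiff 1)^[n] h l

theorem newtonCoeff_zero (h : ℕ → ℂ) (l : ℕ) : newtonCoeff h l 0 = h l := by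
  simp [newtonCoeff]

/-- The recursion in n that is forced on the coefficients by commutation with E₂ - E₁. -/
theorem newtonCoeff_succ (h : ℕ → ℂ) (l n : ℕ) :
    ((n : ℂ) + 1) * newtonCoeff h l (n + 1)
      = ((l : ℂ) + 1) * newtonCoeff h (l + 1) n - ((l : ℂ) + n + 1) * newtonCoeff h l n := by
  have h1 : ((n : ℂ) + 1) * ((l + (n + 1)).choose (n + 1) : ℂ)
      = ((l : ℂ) + n + 1) * ((l + n).choose n : ℂ) := by
    have := Nat.add_one_mul_choose_eq (l + n) n
    have h := congrArg (Nat.cast : ℕ → ℂ) this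
    push_cast at h
    rw [← add_assoc, h]; ring
  have h2 : ((l : ℂ) + 1) * ((l + 1 + n).choose n : ℂ)
      = ((l : ℂ) + n + 1) * ((l + n).choose n : ℂ) := by
    have := Nat.add_one_mul_choose_eq (l + n) l
    have h := congrArg (Nat.cast : ℕ → ℂ) this
    rw [← Nat.choose_symm_add, ← Nat.choose_symm_add, show l + 1 + n = l + n + 1 by ring]
    push_cast at h
    rw [h]; ring
  have h3 : (fwdDiff 1)^[n + 1] h l = (fwdDiff 1)^[n] h (l + 1) - (fwdDiff 1)^[n] h l := by
    rw [Function.iterate_succ_apply']; rfl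
  rw [newtonCoeff, newtonCoeff, newtonCoeff, ← mul_assoc, h1, ← mul_assoc, h2, h3]
  ring

/-- The operator with matrix elements `newtonCoeff`. -/
def newtonOp (h : ℕ → ℂ) : Module.End ℂ (Aux ⊗[ℂ] Aux) :=
  ketBasis.constr ℂ fun b =>
    ∑ n ∈ Finset.range (b.2 + 1), newtonCoeff h b.1 n • ketBasis (b.1 + n, b.2 - n)

theorem newtonOp_ket (h : ℕ → ℂ) (l j : ℕ) : newtonOp h (ketBasis (l, j))
    = ∑ n ∈ Finset.range (j + 1), newtonCoeff h l n • ketBasis (l + n, j - n) := by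
  rw [newtonOp, Module.Basis.constr_basis]

theorem newtonOp_commute_diff (h : ℕ → ℂ) :
    Commute (newtonOp h) (onSnd opMinus - onFst opMinus) := by
  refine two_aux_ext fun l j => ?_
  have hR : ∑ n ∈ Finset.range (j + 1),
        (newtonCoeff h l n * (((j - n : ℕ) : ℂ) + 1)) • ketBasis (l + n, j - n + 1)
      = ∑ n ∈ Finset.range (j + 1),
        (newtonCoeff h l (n + 1) * ((j : ℂ) - n)) • ketBasis (l + n + 1, j - n)
        + (newtonCoeff h l 0 * ((j : ℂ) + 1)) • ketBasis (l, j + 1) := by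
    have : ∀ n ∈ Finset.range (j + 1),
        (newtonCoeff h l n * (((j - n : ℕ) : ℂ) + 1)) • ketBasis (l + n, j - n + 1)
        = (newtonCoeff h l n * ((j : ℂ) + 1 - n)) • ketBasis (l + n, j + 1 - n) := by
      intro n hn
      have hn : n ≤ j := Nat.lt_succ_iff.1 (Finset.mem_range.1 hn)
      rw [Nat.cast_sub hn, Nat.sub_add_comm hn]
      congr 2; ring
    rw [Finset.sum_congr rfl this]
    -- The sum up to n = j + 1 is split at either end: the last term has the factor j + 1 - n = 0,
    -- and the first gives the isolated boundary term.
    have h2 := Finset.sum_range_succ (fun n =>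
      (newtonCoeff h l n * ((j : ℂ) + 1 - n)) • ketBasis (l + n, j + 1 - n)) (j + 1)
    have h3 := Finset.sum_range_succ' (fun n =>
      (newtonCoeff h l n * ((j : ℂ) + 1 - n)) • ketBasis (l + n, j + 1 - n)) (j + 1)
    rw [h2] at h3
    simp only [Nat.cast_add, Nat.cast_one, sub_self, mul_zero, zero_smul, add_zero,
      Nat.cast_zero, sub_zero, Nat.sub_zero, Nat.add_sub_add_right, add_sub_add_right_eq_sub] at h3
    rw [h3]
    rfl
  simp only [Module.End.mul_apply, LinearMap.sub_apply, map_sub, onFst_opMinus_ket,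
    onSnd_opMinus_ket, map_smul, newtonOp_ket, map_sum, smul_sub, smul_smul]
  rw [Finset.sum_sub_distrib, hR, Finset.sum_range_succ']
  simp only [smul_add, Finset.smul_sum, smul_smul, Nat.add_sub_add_right, add_zero, Nat.sub_zero]
  rw [add_sub_right_comm, add_sub_right_comm, ← Finset.sum_sub_distrib, ← Finset.sum_sub_distrib]
  congr 1
  · refine Finset.sum_congr rfl fun n _ => ?_
    rw [show l + 1 + n = l + n + 1 by ring, show l + (n + 1) = l + n + 1 by ring, ← sub_smul,
      ← sub_smul]
    congr 1
    push_cast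
    linear_combination newtonCoeff_succ h l n
  · rw [mul_comm]

/-- Both operators commute with E₂ - E₁ and act on |l,0⟩ as the scalar h(l), which determines them
on all (E₂ - E₁)ʲ|l,0⟩. -/
theorem numberFun_eq_newtonOp (h : ℕ → ℂ) : numberFun h = newtonOp h := by
  refine shear_eq_of_mul_eq (two_aux_ext fun l j => ?_)
  have := LinearMap.congr_fun ((newtonOp_commute_diff h).pow_right j).eq (ketBasis (l, 0))
  simp only [Module.End.mul_apply] at this
  rw [Module.End.mul_apply, Module.End.mul_apply, onFst_opDiag_ket, map_smul, substitute_ket,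
    map_smul, this, newtonOp_ket]
  simp [newtonCoeff_zero, smul_comm (h l)]

/-- One of the n + 1 differences turns h into ½f; the other n expand into the alternating binomial
sum. -/
theorem newtonCoeff_halfPoleSum (x : ℂ) (l n : ℕ) :
    newtonCoeff (halfPoleSum x) l (n + 1) = genLower (l + (n + 1)) l x := by
  have h1 : fwdDiff 1 (halfPoleSum x) = fun k => 1 / 2 * pole k x := by
    funext k
    rw [fwdDiff, halfPoleSum, Finset.sum_range_succ, halfPoleSum, add_sub_cancel_left]
  rw [newtonCoeff, Function.iterate_succ_apply, h1, fwdDiff_iter_eq_sum_shift, genLower,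
    Finset.sum_Ico_eq_sum_range, add_tsub_cancel_left, Nat.add_sub_cancel, Finset.mul_sum,
    Finset.mul_sum, ← Nat.choose_symm_add]
  refine Finset.sum_congr rfl fun k hk => ?_
  have hk : k ≤ n := Nat.lt_succ_iff.1 (Finset.mem_range.1 hk)
  have hsgn : (-1 : ℂ) ^ (n - k) = (-1) ^ n * (-1) ^ k := by
    obtain ⟨d, rfl⟩ := Nat.exists_eq_add_of_le hk
    rw [Nat.add_sub_cancel_left, pow_add, mul_right_comm, ← mul_pow]
    simp
  rw [add_tsub_cancel_left, zsmul_eq_mul]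
  push_cast
  rw [hsgn, smul_eq_mul, mul_one]
  ring

theorem halfPoleSum_sub (x : ℂ) {k l : ℕ} (h : k ≤ l) :
    halfPoleSum x l - halfPoleSum x k = 1 / 2 * ∑ m ∈ Finset.Ico k l, pole m x := by
  rw [halfPoleSum, halfPoleSum, Finset.sum_Ico_eq_sub _ h, mul_sub, Finset.mul_sum, Finset.mul_sum]

/-- h(N₁) only raises the first index and h(N₂) only lowers it, so they supply the two triangles; on
the diagonal h(l) - h(j) telescopes to the sum of poles between l and j. -/
theorem genBlock_apply (x : ℂ) (l j k : ℕ) (hk : k < l + j + 1) :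
    genBlock (l + j) x ⟨k, hk⟩ ⟨l, by omega⟩
      = (if l ≤ k then newtonCoeff (halfPoleSum x) l (k - l) else 0)
        - (if k ≤ l then newtonCoeff (halfPoleSum x) j (l - k) else 0) := by
  simp only [genBlock, Matrix.of_apply, Fin.mk_lt_mk]
  rcases lt_trichotomy l k with h | rfl | h
  · obtain ⟨n, rfl⟩ := Nat.exists_eq_add_of_lt h
    rw [if_pos h, if_pos h.le, if_neg (by omega), sub_zero,
      show l + n + 1 - l = n + 1 by omega, newtonCoeff_halfPoleSum, add_assoc]
  · simp only [lt_irrefl, if_false, le_refl, if_true, Nat.sub_self, newtonCoeff_zero, genDiag]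
    split_ifs with h
    · have h' : l ≤ j := by omega
      have := halfPoleSum_sub x h'
      rw [add_tsub_cancel_left]
      linear_combination this
    · have h' : j ≤ l := by omega
      have := halfPoleSum_sub x h'
      rw [add_tsub_cancel_left, add_tsub_cancel_right]
      linear_combination -this
  · obtain ⟨n, rfl⟩ := Nat.exists_eq_add_of_lt h
    rw [if_neg (by omega), if_pos h, if_neg (by omega), if_pos h.le, zero_sub,
      show k + n + 1 - k = n + 1 by omega, newtonCoeff_halfPoleSum, add_tsub_cancel_left,
      show k + n + 1 + j - k = j + (n + 1) by omega]

theorem blockSum_ket (X : ∀ α : ℕ, Matrix (Fin (α + 1)) (Fin (α + 1)) ℂ) (a b α : ℕ)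
    (h : a + b = α) : blockSum X (ketBasis (a, b))
      = ∑ k : Fin (α + 1), X α k ⟨a, by omega⟩ • ketBasis ((k : ℕ), α - k) := by
  subst h
  rw [blockSum, Module.Basis.constr_basis]

theorem exchange_numberFun_ket (h : ℕ → ℂ) (l j : ℕ) :
    exchange (numberFun h) (ketBasis (l, j))
      = ∑ n ∈ Finset.range (l + 1), newtonCoeff h j n • ketBasis (l - n, j + n) := by
  rw [exchange_apply, ketBasis_apply, TensorProduct.comm_tmul, ← ketBasis_apply,
    numberFun_eq_newtonOp, newtonOp_ket, map_sum]
  refine Finset.sum_congr rfl fun n _ => ?_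
  rw [map_smul, ketBasis_apply, TensorProduct.comm_tmul, ketBasis_apply]

theorem gen_eq (x : ℂ) :
    gen x = numberFun (halfPoleSum x) - exchange (numberFun (halfPoleSum x)) := by
  refine two_aux_ext fun l j => ?_
  have h1 : gen x (ketBasis (l, j)) = ∑ k ∈ Finset.range (l + j + 1),
      ((if l ≤ k then newtonCoeff (halfPoleSum x) l (k - l) else 0)
        - (if k ≤ l then newtonCoeff (halfPoleSum x) j (l - k) else 0)) • ketBasis (k, l + j - k) := by
    rw [gen, blockSum_ket _ l j _ rfl, Finset.sum_range]
    refine Finset.sum_congr rfl fun k _ => ?_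
    rw [← genBlock_apply x l j k k.2]
  have h2 : ∑ k ∈ Finset.range (l + j + 1), (if l ≤ k then newtonCoeff (halfPoleSum x) l (k - l)
      else 0) • ketBasis (k, l + j - k) = numberFun (halfPoleSum x) (ketBasis (l, j)) := by
    rw [numberFun_eq_newtonOp, newtonOp_ket, add_assoc, Finset.sum_range_add,
      Finset.sum_eq_zero (s := Finset.range l), zero_add]
    · refine Finset.sum_congr rfl fun n _ => ?_
      rw [if_pos (Nat.le_add_right l n), Nat.add_sub_cancel_left, Nat.add_sub_add_left]
    · intro k hk
      rw [if_neg (not_le.2 (Finset.mem_range.1 hk)), zero_smul]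
  have h3 : ∑ k ∈ Finset.range (l + j + 1), (if k ≤ l then newtonCoeff (halfPoleSum x) j (l - k)
      else 0) • ketBasis (k, l + j - k)
      = exchange (numberFun (halfPoleSum x)) (ketBasis (l, j)) := by
    rw [exchange_numberFun_ket, add_right_comm, Finset.sum_range_add,
      Finset.sum_eq_zero (s := Finset.range j), add_zero, ← Finset.sum_range_reflect]
    · refine Finset.sum_congr rfl fun n hn => ?_
      have hn := Finset.mem_range.1 hn
      rw [if_pos (by omega), show l - (l + 1 - 1 - n) = n by omega,
        show l + 1 - 1 - n = l - n by omega, show l + j - (l - n) = j + n by omega]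
    · intro k _
      rw [if_neg (by omega), zero_smul]
  rw [h1, LinearMap.sub_apply, ← h2, ← h3, ← Finset.sum_sub_distrib]
  exact Finset.sum_congr rfl fun k _ => sub_smul _ _ _

/-! ### The block exponential -/

theorem blockSum_mul (X Y : ∀ α : ℕ, Matrix (Fin (α + 1)) (Fin (α + 1)) ℂ) :
    blockSum X * blockSum Y = blockSum fun α => X α * Y α := by
  refine two_aux_ext fun a b => ?_
  rw [Module.End.mul_apply, blockSum_ket Y a b _ rfl, map_sum, blockSum_ket _ a b _ rfl]
  simp only [Matrix.mul_apply, Finset.sum_smul]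
  rw [Finset.sum_comm]
  refine Finset.sum_congr rfl fun m _ => ?_
  rw [map_smul, blockSum_ket X m (a + b - m) (a + b) (by omega), Finset.smul_sum]
  refine Finset.sum_congr rfl fun k _ => ?_
  rw [smul_smul, mul_comm]

theorem blockSum_one : blockSum (fun _ => 1) = 1 := by
  refine two_aux_ext fun a b => ?_
  rw [blockSum_ket _ a b _ rfl, Finset.sum_eq_single ⟨a, by omega⟩]
  · simp
  · intro k _ hk
    rw [Matrix.one_apply_ne hk, zero_smul]
  · simp

theorem blockSum_pow (X : ∀ α : ℕ, Matrix (Fin (α + 1)) (Fin (α + 1)) ℂ) (j : ℕ) :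
    blockSum X ^ j = blockSum fun α => X α ^ j := by
  induction j with
  | zero => simp only [pow_zero, blockSum_one]
  | succ j ih => simp only [pow_succ, ih, blockSum_mul]

theorem smul_blockSum (c : ℂ) (X : ∀ α : ℕ, Matrix (Fin (α + 1)) (Fin (α + 1)) ℂ) :
    c • blockSum X = blockSum fun α => c • X α := by
  refine two_aux_ext fun a b => ?_
  rw [LinearMap.smul_apply, blockSum_ket _ a b _ rfl, blockSum_ket _ a b _ rfl, Finset.smul_sum]
  simp only [smul_smul, Matrix.smul_apply, smul_eq_mul]

open scoped Matrix.Norms.Operator in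
theorem hasSum_exp_apply {ι : Type*} [Fintype ι] [DecidableEq ι] (M : Matrix ι ι ℂ) (k l : ι) :
    HasSum (fun j : ℕ => ((j.factorial : ℂ))⁻¹ * (M ^ j) k l) (NormedSpace.exp M k l) := by
  have h := NormedSpace.exp_series_hasSum_exp' (𝕂 := ℂ) M
  exact Pi.hasSum.1 (Pi.hasSum.1 h k) l

/-- On a basis vector only one finite block acts, so the claim is entrywise convergence of a matrix
exponential; linearity extends it to all vectors. -/
theorem isWeakExp_blockSum (M : ∀ α : ℕ, Matrix (Fin (α + 1)) (Fin (α + 1)) ℂ) :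
    IsWeakExp (blockSum fun α => NormedSpace.exp (M α)) (blockSum M) := by
  intro φ v
  have hv : v ∈ Submodule.span ℂ (Set.range ketBasis) := by
    rw [ketBasis.span_eq]; exact Submodule.mem_top
  induction hv using Submodule.span_induction with
  | mem v hv =>
    obtain ⟨⟨a, b⟩, rfl⟩ := hv
    simp only [blockSum_pow, blockSum_ket _ a b _ rfl, map_sum, Finset.mul_sum, map_smul,
      smul_eq_mul, ← mul_assoc]
    exact hasSum_sum fun k _ => (hasSum_exp_apply _ _ _).mul_right _
  | zero => simp
  | add u v _ _ hu hv => simpa only [map_add, mul_add] using hu.add hv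
  | smul c v _ hv => simpa only [map_smul, smul_eq_mul, mul_left_comm] using hv.mul_left c

theorem isWeakExp_rMatrix (x y : ℂ) :
    IsWeakExp (rMatrix (x + y / 2) (x - y / 2)) (y • gen x) := by
  rw [gen, smul_blockSum, rMatrix, show x + y / 2 - (x - y / 2) = y by ring,
    show (x + y / 2 + (x - y / 2)) / 2 = x by ring]
  exact isWeakExp_blockSum fun α => y • genBlock α x

theorem isExpOf_rMatrix (x y : ℂ) :
    IsExpOf (rMatrix (x + y / 2) (x - y / 2)) (y • gen x) :=
  fun b c => isWeakExp_rMatrix x y (ketBasis.coord b) (ketBasis c)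

theorem genBlock_zero (x : ℂ) : genBlock 0 x = 0 := by
  ext k l
  obtain rfl : k = 0 := Fin.fin_one_eq_zero k
  obtain rfl : l = 0 := Fin.fin_one_eq_zero l
  simp [genBlock, genDiag]

theorem rMatrix_vacuum (p p' : ℂ) : rMatrix p p' (ketBasis (0, 0)) = ketBasis (0, 0) := by
  rw [rMatrix, blockSum_ket _ 0 0 0 rfl]
  simp [genBlock_zero]

/-- Blocks preserve α, and |0,0⟩ is the only basis vector with α = 0. -/
theorem vacuum_rMatrix (p p' : ℂ) :
    ketBasis.coord (0, 0) ∘ₗ rMatrix p p' = ketBasis.coord (0, 0) := by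
  refine two_aux_ext fun a b => ?_
  rw [LinearMap.comp_apply]
  rcases Nat.eq_zero_or_pos (a + b) with h | h
  · obtain ⟨rfl, rfl⟩ : a = 0 ∧ b = 0 := by omega
    rw [rMatrix_vacuum]
  · rw [rMatrix, blockSum_ket _ a b _ rfl, map_sum, Finset.sum_eq_zero]
    · rw [Module.Basis.coord_apply, Module.Basis.repr_self, Finsupp.single_apply, if_neg]
      rw [Prod.mk.injEq]; omega
    · intro k _
      rw [map_smul, Module.Basis.coord_apply, Module.Basis.repr_self, Finsupp.single_apply, if_neg,
        smul_zero]
      rw [Prod.mk.injEq]; omega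

/-! ### The RLL relation for the matrix elements of the Lax operators -/

namespace DigammaPair

variable {A : Type*} [Ring A] [Algebra ℂ A] {x : ℂ} {E₁ E₂ T₁ T₂ Φ₁ Φ₂ s t : A}

/-- Normal ordering, with each E moved left of each T, exposes the powers of y. The next three
lemmas do the same for the other entries. -/
theorem entryA_eq (h : DigammaPair x E₁ E₂ T₁ T₂ Φ₁ Φ₂ s t) (y : ℂ) :
    ((x + y / 2) • 1 - E₁ * T₁) * ((x - y / 2) • 1 - E₂ * T₂)
        + (E₁ * T₁ - (2 * (x + y / 2)) • 1) * T₁ * E₂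
      = entryA₀ x E₁ E₂ T₁ T₂ + y • entryA₁ E₁ E₂ T₁ T₂ - (y ^ 2 / 4) • 1 := by
  have h12 : ∀ z, T₁ * (E₂ * z) = E₂ * (T₁ * z) := fun z => by
    rw [← mul_assoc, h.te₁₂, mul_assoc]
  simp only [entryA₀, entryA₁, entryC₀, mul_add, add_mul, mul_sub, sub_mul, smul_mul_assoc,
    mul_smul_comm, mul_assoc, mul_one, one_mul, h.te₁₂, h12, ← h.tt]
  module

theorem entryB_eq (h : DigammaPair x E₁ E₂ T₁ T₂ Φ₁ Φ₂ s t) (y : ℂ) :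
    ((x + y / 2) • 1 - E₁ * T₁) * ((E₂ * T₂ - (2 * (x - y / 2)) • 1) * T₂)
        + (E₁ * T₁ - (2 * (x + y / 2)) • 1) * T₁ * ((x - y / 2) • 1 - E₂ * T₂)
      = entryB₀ x E₁ E₂ T₁ T₂ + y • entryB₁ E₁ E₂ T₁ T₂ + (y ^ 2 / 2) • (T₁ + T₂) := by
  have h12 : ∀ z, T₁ * (E₂ * z) = E₂ * (T₁ * z) := fun z => by
    rw [← mul_assoc, h.te₁₂, mul_assoc]
  have ht : ∀ z, T₂ * (T₁ * z) = T₁ * (T₂ * z) := fun z => by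
    rw [← mul_assoc, ← h.tt, mul_assoc]
  simp only [entryB₀, entryB₁, entryC₀, mul_add, add_mul, mul_sub, sub_mul, smul_mul_assoc,
    mul_smul_comm, mul_assoc, mul_one, one_mul, h12, ← h.tt, ht]
  module

theorem entryC_eq (h : DigammaPair x E₁ E₂ T₁ T₂ Φ₁ Φ₂ s t) (y : ℂ) :
    E₁ * ((x - y / 2) • 1 - E₂ * T₂) + ((x + y / 2) • 1 - E₁ * T₁) * E₂
      = entryC₀ x E₁ E₂ T₁ T₂ - (y / 2) • (E₁ - E₂) := by
  simp only [entryC₀, mul_add, mul_sub, sub_mul, smul_mul_assoc, mul_smul_comm, mul_assoc, mul_one,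
    one_mul, h.te₁₂]
  module

theorem entryD_eq (h : DigammaPair x E₁ E₂ T₁ T₂ Φ₁ Φ₂ s t) (y : ℂ) :
    E₁ * ((E₂ * T₂ - (2 * (x - y / 2)) • 1) * T₂)
        + ((x + y / 2) • 1 - E₁ * T₁) * ((x - y / 2) • 1 - E₂ * T₂)
      = entryA₀ x E₂ E₁ T₂ T₁ - y • entryA₁ E₂ E₁ T₂ T₁ - (y ^ 2 / 4) • 1 := by
  have h12 : ∀ z, T₁ * (E₂ * z) = E₂ * (T₁ * z) := fun z => by
    rw [← mul_assoc, h.te₁₂, mul_assoc]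
  have he : ∀ z, E₂ * (E₁ * z) = E₁ * (E₂ * z) := fun z => by
    rw [← mul_assoc, ← h.ee, mul_assoc]
  simp only [entryA₀, entryA₁, entryC₀, mul_add, add_mul, mul_sub, sub_mul, smul_mul_assoc,
    mul_smul_comm, mul_assoc, mul_one, one_mul, h12, he]
  module

end DigammaPair

theorem isWeakExp_rMatrix_number (x y : ℂ) : IsWeakExp (rMatrix (x + y / 2) (x - y / 2))
    (y • (numberFun (halfPoleSum x) - exchange (numberFun (halfPoleSum x)))) := by
  rw [← gen_eq]; exact isWeakExp_rMatrix x y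

theorem onFst_opZero (p : ℂ) : onFst (opZero p) = p • 1 - onFst opMinus * onFst opLower := by
  rw [opZero_eq, map_sub, map_smul, map_one, map_mul]

theorem onSnd_opZero (p : ℂ) : onSnd (opZero p) = p • 1 - onSnd opMinus * onSnd opLower := by
  rw [opZero_eq, map_sub, map_smul, map_one, map_mul]

theorem onFst_opPlus (p : ℂ) :
    onFst (opPlus p) = (onFst opMinus * onFst opLower - (2 * p) • 1) * onFst opLower := by
  rw [opPlus_eq, map_mul, map_sub, map_smul, map_one, map_mul]

theorem onSnd_opPlus (p : ℂ) :
    onSnd (opPlus p) = (onSnd opMinus * onSnd opLower - (2 * p) • 1) * onSnd opLower := by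
  rw [opPlus_eq, map_mul, map_sub, map_smul, map_one, map_mul]

theorem add_half_eq (x y : ℂ) : x + y / 2 = x - -y / 2 := by ring

theorem sub_half_eq (x y : ℂ) : x - y / 2 = x + -y / 2 := by ring

theorem rMatrix_mul_entryA {x : ℂ} (hx : ∀ m : ℕ, x ≠ (m : ℂ) / 2) (y : ℂ) :
    rMatrix (x + y / 2) (x - y / 2) * (onFst (opZero (x + y / 2)) * onSnd (opZero (x - y / 2))
        + onFst (opPlus (x + y / 2)) * onSnd opMinus)
      = (onFst (opZero (x - y / 2)) * onSnd (opZero (x + y / 2))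
        + onFst (opPlus (x - y / 2)) * onSnd opMinus) * rMatrix (x + y / 2) (x - y / 2) := by
  have h := digammaPair hx
  have h1 := h.entryA_eq y
  -- Replacing y by -y gives the entry with p and p' exchanged.
  have h2 := h.entryA_eq (-y)
  rw [← add_half_eq, ← sub_half_eq, neg_smul, ← sub_eq_add_neg, neg_sq] at h2
  rw [onFst_opZero, onSnd_opZero, onFst_opPlus, onFst_opZero, onSnd_opZero, onFst_opPlus, h1, h2]
  exact h.exp_entryA (isWeakExp_rMatrix_number x y)

theorem rMatrix_mul_entryB {x : ℂ} (hx : ∀ m : ℕ, x ≠ (m : ℂ) / 2) (y : ℂ) :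
    rMatrix (x + y / 2) (x - y / 2) * (onFst (opZero (x + y / 2)) * onSnd (opPlus (x - y / 2))
        + onFst (opPlus (x + y / 2)) * onSnd (opZero (x - y / 2)))
      = (onFst (opZero (x - y / 2)) * onSnd (opPlus (x + y / 2))
        + onFst (opPlus (x - y / 2)) * onSnd (opZero (x + y / 2)))
          * rMatrix (x + y / 2) (x - y / 2) := by
  have h := digammaPair hx
  have h1 := h.entryB_eq y
  have h2 := h.entryB_eq (-y)
  rw [← add_half_eq, ← sub_half_eq, neg_smul, ← sub_eq_add_neg, neg_sq] at h2
  rw [onFst_opZero, onSnd_opZero, onFst_opPlus, onFst_opZero, onSnd_opZero, onFst_opPlus,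
    onSnd_opPlus, onSnd_opPlus, h1, h2]
  exact h.exp_entryB (isWeakExp_rMatrix_number x y)

theorem rMatrix_mul_entryC {x : ℂ} (hx : ∀ m : ℕ, x ≠ (m : ℂ) / 2) (y : ℂ) :
    rMatrix (x + y / 2) (x - y / 2) * (onFst opMinus * onSnd (opZero (x - y / 2))
        + onFst (opZero (x + y / 2)) * onSnd opMinus)
      = (onFst opMinus * onSnd (opZero (x + y / 2))
        + onFst (opZero (x - y / 2)) * onSnd opMinus) * rMatrix (x + y / 2) (x - y / 2) := by
  have h := digammaPair hx
  have h1 := h.entryC_eq y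
  have h2 := h.entryC_eq (-y)
  rw [← add_half_eq, ← sub_half_eq, neg_div, neg_smul, sub_neg_eq_add] at h2
  rw [onFst_opZero, onSnd_opZero, onFst_opZero, onSnd_opZero, h1, h2]
  exact h.exp_entryC (isWeakExp_rMatrix_number x y)

theorem rMatrix_mul_entryD {x : ℂ} (hx : ∀ m : ℕ, x ≠ (m : ℂ) / 2) (y : ℂ) :
    rMatrix (x + y / 2) (x - y / 2) * (onFst opMinus * onSnd (opPlus (x - y / 2))
        + onFst (opZero (x + y / 2)) * onSnd (opZero (x - y / 2)))
      = (onFst opMinus * onSnd (opPlus (x + y / 2))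
        + onFst (opZero (x - y / 2)) * onSnd (opZero (x + y / 2)))
          * rMatrix (x + y / 2) (x - y / 2) := by
  have h := digammaPair hx
  have h1 := h.entryD_eq y
  have h2 := h.entryD_eq (-y)
  rw [← add_half_eq, ← sub_half_eq, neg_smul, sub_neg_eq_add, neg_sq] at h2
  rw [onFst_opZero, onSnd_opZero, onFst_opZero, onSnd_opZero, onSnd_opPlus, onSnd_opPlus, h1, h2]
  exact h.exp_entryD (isWeakExp_rMatrix_number x y)

/-! ### Operators on one site of the chain -/

/-- A two by two matrix with entries in `B`, acting on site `k` of the chain. -/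
def siteMatrix {B : Type*} [Semiring B] {n : ℕ} (k : Fin n) (M : Matrix (Fin 2) (Fin 2) B) :
    Matrix (Config n) (Config n) B :=
  Matrix.of fun ν ν' => if ∀ j, j ≠ k → ν j = ν' j then M (ν k) (ν' k) else 0

section Site

variable {B : Type*} [Semiring B] {n : ℕ}

theorem siteMatrix_apply (k : Fin n) (M : Matrix (Fin 2) (Fin 2) B) (ν ν' : Config n) :
    siteMatrix k M ν ν' = if ∀ j, j ≠ k → ν j = ν' j then M (ν k) (ν' k) else 0 := rfl

theorem siteMatrix_map {C : Type*} [Semiring C] (f : B →+* C) (k : Fin n)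
    (M : Matrix (Fin 2) (Fin 2) B) : (siteMatrix k M).map f = siteMatrix k (M.map f) := by
  ext ν ν'
  simp only [siteMatrix_apply, Matrix.map_apply, apply_ite f, map_zero]

theorem siteMatrix_mul (k : Fin n) (M N : Matrix (Fin 2) (Fin 2) B) :
    siteMatrix k M * siteMatrix k N = siteMatrix k (M * N) := by
  ext ν ν'
  -- Only intermediate configurations that agree with ν away from site k contribute.
  have hsub : ∑ μ : Config n, siteMatrix k M ν μ * siteMatrix k N μ ν'
      = ∑ i : Fin 2, siteMatrix k M ν (Function.update ν k i)
          * siteMatrix k N (Function.update ν k i) ν' := by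
    rw [← Finset.sum_image (s := Finset.univ) (g := Function.update ν k)
      (f := fun μ => siteMatrix k M ν μ * siteMatrix k N μ ν')
      (fun i _ j _ h => Function.update_injective ν k h)]
    refine (Finset.sum_subset (Finset.subset_univ _) fun μ _ hμ => ?_).symm
    rw [siteMatrix_apply, if_neg, zero_mul]
    intro h
    refine hμ (Finset.mem_image.2 ⟨μ k, Finset.mem_univ _, ?_⟩)
    funext j
    by_cases hj : j = k
    · subst hj; simp
    · simp [hj, h j hj]
  rw [Matrix.mul_apply, hsub]
  have h1 : ∀ i, siteMatrix k M ν (Function.update ν k i) = M (ν k) i := by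
    intro i
    rw [siteMatrix_apply, if_pos, Function.update_self]
    intro j hj
    rw [Function.update_of_ne hj]
  have h2 : ∀ i, siteMatrix k N (Function.update ν k i) ν'
      = if ∀ j, j ≠ k → ν j = ν' j then N i (ν' k) else 0 := by
    intro i
    rw [siteMatrix_apply, Function.update_self]
    refine if_congr (forall₂_congr fun j hj => ?_) rfl rfl
    rw [Function.update_of_ne hj]
  simp only [h1, h2]
  rw [siteMatrix_apply]
  split_ifs
  · rw [Matrix.mul_apply]
  · simp

theorem siteMatrix_mul_apply_of_ne {j k : Fin n} (hjk : j ≠ k) (M N : Matrix (Fin 2) (Fin 2) B)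
    (ν ν' : Config n) : (siteMatrix j M * siteMatrix k N) ν ν'
      = if ∀ i, i ≠ j → i ≠ k → ν i = ν' i then M (ν j) (ν' j) * N (ν k) (ν' k) else 0 := by
  -- The first factor can change only site j and the second leaves it alone, so the intermediate
  -- configuration already has the final value at j.
  rw [Matrix.mul_apply, Finset.sum_eq_single (Function.update ν j (ν' j))]
  · have h1 : siteMatrix j M ν (Function.update ν j (ν' j)) = M (ν j) (ν' j) := by
      rw [siteMatrix_apply, if_pos, Function.update_self]
      intro i hi
      rw [Function.update_of_ne hi]
    have h2 : (∀ i, i ≠ k → Function.update ν j (ν' j) i = ν' i)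
        ↔ ∀ i, i ≠ j → i ≠ k → ν i = ν' i := by
      constructor
      · intro h i hi hi'
        rw [← h i hi', Function.update_of_ne hi]
      · intro h i hi
        by_cases hij : i = j
        · subst hij; simp
        · rw [Function.update_of_ne hij, h i hij hi]
    rw [h1, siteMatrix_apply, Function.update_of_ne hjk.symm, if_congr h2 rfl rfl,
      mul_ite, mul_zero]
  · intro μ _ hμ
    by_cases h1 : ∀ i, i ≠ j → ν i = μ i
    · rw [siteMatrix_apply k, if_neg, mul_zero]
      intro h2
      refine hμ (funext fun i => ?_)
      by_cases hij : i = j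
      · subst hij
        rw [Function.update_self, h2 i hjk]
      · rw [Function.update_of_ne hij, h1 i hij]
    · rw [siteMatrix_apply, if_neg h1, zero_mul]
  · intro h
    exact absurd (Finset.mem_univ _) h

theorem siteMatrix_commute {j k : Fin n} (hjk : j ≠ k) {M N : Matrix (Fin 2) (Fin 2) B}
    (h : ∀ a b c d, Commute (M a b) (N c d)) : Commute (siteMatrix j M) (siteMatrix k N) := by
  ext ν ν'
  rw [siteMatrix_mul_apply_of_ne hjk, siteMatrix_mul_apply_of_ne hjk.symm]
  refine if_congr (forall_congr' fun i => ?_) (h _ _ _ _).eq rfl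
  exact ⟨fun h a b => h b a, fun h a b => h b a⟩

end Site

/-- The Lax operator of a single site. -/
def laxMatrix (p : ℂ) : Matrix (Fin 2) (Fin 2) (Module.End ℂ Aux) :=
  !![opZero p, opPlus p; opMinus, opZero p]

theorem lax_eq {n : ℕ} (k : Fin n) (p : ℂ) : lax k p = siteMatrix k (laxMatrix p) := by
  ext1 ν ν'
  simp only [lax, opTensor, atSite, siteMatrix, Matrix.add_apply, Matrix.map_apply,
    Matrix.of_apply, sigmaZero, sigmaPlus, sigmaMinus, laxMatrix]
  split_ifs
  · generalize ν k = a
    generalize ν' k = b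
    fin_cases a <;> fin_cases b <;> simp
  · simp

theorem laxFst_eq {n : ℕ} (k : Fin n) (p : ℂ) :
    laxFst k p = siteMatrix k ((laxMatrix p).map onFst) := by
  rw [laxFst, lax_eq]
  exact siteMatrix_map onFst.toRingHom k _

theorem laxSnd_eq {n : ℕ} (k : Fin n) (p : ℂ) :
    laxSnd k p = siteMatrix k ((laxMatrix p).map onSnd) := by
  rw [laxSnd, lax_eq]
  exact siteMatrix_map onSnd.toRingHom k _

theorem onAux_mul_apply {n : ℕ} (R : Module.End ℂ (Aux ⊗[ℂ] Aux))
    (X : Matrix (Config n) (Config n) (Module.End ℂ (Aux ⊗[ℂ] Aux))) (ν ν' : Config n) :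
    (onAux (n := n) R * X) ν ν' = R * X ν ν' := by
  simp [onAux, opTensor, Matrix.mul_apply, Matrix.one_apply, ite_smul]

theorem mul_onAux_apply {n : ℕ} (R : Module.End ℂ (Aux ⊗[ℂ] Aux))
    (X : Matrix (Config n) (Config n) (Module.End ℂ (Aux ⊗[ℂ] Aux))) (ν ν' : Config n) :
    (X * onAux (n := n) R) ν ν' = X ν ν' * R := by
  simp [onAux, opTensor, Matrix.mul_apply, Matrix.one_apply, ite_smul]

/-- The RLL relation. -/
theorem rMatrix_rll {x : ℂ} (hx : ∀ m : ℕ, x ≠ (m : ℂ) / 2) (y : ℂ) (n : ℕ) (k : Fin n) :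
    onAux (rMatrix (x + y / 2) (x - y / 2)) * laxFst k (x + y / 2) * laxSnd k (x - y / 2)
      = laxFst k (x - y / 2) * laxSnd k (x + y / 2)
        * onAux (rMatrix (x + y / 2) (x - y / 2)) := by
  simp only [laxFst_eq, laxSnd_eq]
  rw [mul_assoc, siteMatrix_mul, siteMatrix_mul]
  ext1 ν ν'
  rw [onAux_mul_apply, mul_onAux_apply]
  simp only [siteMatrix_apply]
  split_ifs
  · rw [Matrix.mul_apply, Matrix.mul_apply, Fin.sum_univ_two, Fin.sum_univ_two]
    generalize ν k = a
    generalize ν' k = b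
    fin_cases a <;> fin_cases b
    · exact rMatrix_mul_entryA hx y
    · exact rMatrix_mul_entryB hx y
    · exact rMatrix_mul_entryC hx y
    · exact rMatrix_mul_entryD hx y
  · rw [mul_zero, zero_mul]

/-! ### Commuting transfer operators -/

/-- Each G moves left past the F factors of the other indices. Without repetitions it never has to
pass the F of its own index. -/
theorem list_prod_mul_prod {M ι : Type*} [Monoid M] {F G : ι → M}
    (h : ∀ i j, i ≠ j → Commute (F i) (G j)) : ∀ l : List ι, l.Nodup →
    (l.map F).prod * (l.map G).prod = (l.map fun i => F i * G i).prod
  | [], _ => by simp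
  | a :: l, hl => by
    rw [List.nodup_cons] at hl
    have hc : Commute (l.map F).prod (G a) := by
      refine Commute.list_prod_left _ _ fun z hz => ?_
      obtain ⟨i, hi, rfl⟩ := List.mem_map.1 hz
      exact h i a fun e => hl.1 (e ▸ hi)
    simp only [List.map_cons, List.prod_cons]
    rw [mul_assoc, ← mul_assoc _ (G a), hc.eq, ← list_prod_mul_prod h l hl.2]
    simp only [mul_assoc]

theorem commute_laxFst_laxSnd {n : ℕ} {j k : Fin n} (hjk : j ≠ k) (p p' : ℂ) :
    Commute (laxFst j p) (laxSnd k p') := by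
  rw [laxFst_eq, laxSnd_eq]
  exact siteMatrix_commute hjk fun a b c d => commute_onFst_onSnd _ _

theorem monodromy_map (n : ℕ) (p : ℂ)
    (f : Module.End ℂ Aux →ₐ[ℂ] Module.End ℂ (Aux ⊗[ℂ] Aux)) :
    (monodromy n p).map f = ((List.finRange n).map fun k => (lax k p).map f).prod := by
  have h := map_list_prod (f : Module.End ℂ Aux →+* Module.End ℂ (Aux ⊗[ℂ] Aux)).mapMatrix
    (List.ofFn fun k : Fin n => lax k p)
  rw [List.ofFn_eq_map, List.map_map] at h
  rw [monodromy, List.ofFn_eq_map]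
  exact h

theorem coord_vacuum_mul (A B : Module.End ℂ Aux) :
    ketBasis.coord (0, 0) ((onFst A * onSnd B) (ketBasis (0, 0)))
      = A (ket 0) 0 * B (ket 0) 0 := by
  rw [Module.End.mul_apply, ketBasis_apply, onSnd_tmul, onFst_tmul, Module.Basis.coord_apply,
    ketBasis, Module.Basis.tensorProduct_repr_tmul_apply]
  simp [mul_comm]

/-- The vacuum expectation factorises over the two auxiliary spaces, so a product of transfer
operators is one vacuum expectation of sitewise paired Lax operators, the form on which the RLL
relation acts. -/
theorem transfer_mul_apply (n : ℕ) (p p' : ℂ) (ν ν' : Config n) :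
    (transfer n p * transfer n p') ν ν' = ketBasis.coord (0, 0)
      (((List.finRange n).map fun k => laxFst k p * laxSnd k p').prod ν ν' (ketBasis (0, 0))) := by
  rw [← list_prod_mul_prod (fun i j hij => commute_laxFst_laxSnd hij p p') _
    (List.nodup_finRange n)]
  have h1 : ((List.finRange n).map fun k => laxFst k p).prod = (monodromy n p).map onFst :=
    (monodromy_map n p onFst).symm
  have h2 : ((List.finRange n).map fun k => laxSnd k p').prod = (monodromy n p').map onSnd :=
    (monodromy_map n p' onSnd).symm
  rw [h1, h2, Matrix.mul_apply, Matrix.mul_apply, LinearMap.sum_apply, map_sum]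
  exact Finset.sum_congr rfl fun μ _ => (coord_vacuum_mul _ _).symm

theorem transfer_commute_of_ne {p p' : ℂ} (h : ∀ m : ℕ, p + p' ≠ m) (n : ℕ) :
    transfer n p * transfer n p' = transfer n p' * transfer n p := by
  have hx : ∀ m : ℕ, (p + p') / 2 ≠ (m : ℂ) / 2 := fun m hm =>
    h m (by linear_combination 2 * hm)
  have hrll := rMatrix_rll hx (p - p') n
  rw [show (p + p') / 2 + (p - p') / 2 = p by ring,
    show (p + p') / 2 - (p - p') / 2 = p' by ring] at hrll
  -- The train argument: each RLL relation carries R past one site and exchanges p and p' there.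
  have htrain : ∀ l : List (Fin n),
      onAux (rMatrix p p') * (l.map fun k => laxFst k p * laxSnd k p').prod
        = (l.map fun k => laxFst k p' * laxSnd k p).prod * onAux (rMatrix p p') := by
    intro l
    induction l with
    | nil => simp
    | cons k l ih =>
      simp only [List.map_cons, List.prod_cons]
      rw [← mul_assoc, ← mul_assoc, hrll k, mul_assoc, ih]
      simp only [mul_assoc]
  ext ν ν'
  have h1 := congrFun₂ (htrain (List.finRange n)) ν ν'
  rw [onAux_mul_apply, mul_onAux_apply] at h1
  have h2 := congrArg (ketBasis.coord (0, 0)) (LinearMap.congr_fun h1 (ketBasis (0, 0)))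
  rw [Module.End.mul_apply, Module.End.mul_apply, rMatrix_vacuum] at h2
  rw [transfer_mul_apply, transfer_mul_apply, ← h2]
  exact (LinearMap.congr_fun (vacuum_rMatrix p p') _).symm

/-- Induction peels off the rightmost factor, which acts first and sends |k⟩ to multiples of |k-1⟩,
|k⟩, |k+1⟩; hence the statement ranges over all k, not just the vacuum. -/
theorem continuous_lax_prod_apply {n : ℕ} (l : List (Fin n)) :
    ∀ (ν ν' : Config n) (k i : ℕ),
      Continuous fun p : ℂ => ((l.map fun j => lax j p).prod ν ν') (ket k) i := by
  induction l using List.reverseRecOn with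
  | nil => intro ν ν' k i; simpa using continuous_const
  | append_singleton l j ih =>
    intro ν ν' k i
    simp only [List.map_append, List.prod_append, List.map_cons, List.map_nil, List.prod_singleton,
      Matrix.mul_apply, LinearMap.sum_apply, Module.End.mul_apply, Finsupp.finsetSum_apply]
    refine continuous_finsetSum _ fun μ _ => ?_
    simp only [lax, opTensor, Matrix.add_apply, Matrix.map_apply, LinearMap.add_apply,
      LinearMap.smul_apply, opZero_ket, opMinus_ket, map_add, map_smul, Finsupp.add_apply,
      Finsupp.smul_apply, ampZero, smul_eq_mul]
    have h0 := ih ν μ k i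
    have h1 := ih ν μ (k + 1) i
    have h2 : Continuous fun p : ℂ =>
        ((l.map fun j => lax j p).prod ν μ) (opPlus p (ket k)) i := by
      cases k with
      | zero => simpa [opPlus_ket_zero] using continuous_const
      | succ k =>
        have h3 := ih ν μ k i
        simp only [opPlus_ket_succ, map_smul, Finsupp.smul_apply, ampPlus, smul_eq_mul]
        fun_prop
    fun_prop

theorem continuous_transfer (n : ℕ) : Continuous fun p : ℂ => transfer n p := by
  refine continuous_pi fun ν => continuous_pi fun ν' => ?_
  simp only [transfer, monodromy, Matrix.map_apply, List.ofFn_eq_map]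
  exact continuous_lax_prod_apply _ ν ν' 0 0

/-- For fixed p the exceptional p' form the countable set ℕ - p, whose complement is dense, and both
products are continuous in p'. -/
theorem transfer_commute (n : ℕ) (p p' : ℂ) :
    transfer n p * transfer n p' = transfer n p' * transfer n p := by
  have hcount : (Set.range fun m : ℕ => (m : ℂ) - p).Countable := Set.countable_range _
  have hdense : Dense (Set.range fun m : ℕ => (m : ℂ) - p)ᶜ := hcount.dense_compl ℂ
  have hc := continuous_transfer n
  refine congrFun (Continuous.ext_on hdense (f := fun q => transfer n p * transfer n q)
    (g := fun q => transfer n q * transfer n p) (continuous_const.matrix_mul hc)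
    (hc.matrix_mul continuous_const) fun q hq => ?_) p'
  exact transfer_commute_of_ne (fun m hm => hq ⟨m, by simp only; linear_combination -hm⟩) n

end ExteriorIntegrability

end

theorem theorem1 :
    (∀ x y : ℂ, (∀ m : ℕ, x ≠ (m : ℂ) / 2) →
      -- `Ř(x + y/2, x - y/2) = exp (y H(x))`
      ExteriorIntegrability.IsExpOf
        (ExteriorIntegrability.rMatrix (x + y / 2) (x - y / 2))
        (y • ExteriorIntegrability.gen x) ∧
      -- the RLL relation at every site of a chain of any length
      (∀ (n : ℕ) (k : Fin n),
        ExteriorIntegrability.onAux (ExteriorIntegrability.rMatrix (x + y / 2) (x - y / 2))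
            * ExteriorIntegrability.laxFst k (x + y / 2)
            * ExteriorIntegrability.laxSnd k (x - y / 2)
          = ExteriorIntegrability.laxFst k (x - y / 2)
            * ExteriorIntegrability.laxSnd k (x + y / 2)
            * ExteriorIntegrability.onAux
                (ExteriorIntegrability.rMatrix (x + y / 2) (x - y / 2))) ∧
      -- `Ř |0,0⟩ = |0,0⟩` and `⟨0,0| Ř = ⟨0,0|`
      ExteriorIntegrability.rMatrix (x + y / 2) (x - y / 2)
          (ExteriorIntegrability.ketBasis (0, 0)) = ExteriorIntegrability.ketBasis (0, 0) ∧
      ExteriorIntegrability.ketBasis.coord (0, 0)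
          ∘ₗ ExteriorIntegrability.rMatrix (x + y / 2) (x - y / 2)
        = ExteriorIntegrability.ketBasis.coord (0, 0)) ∧
    -- the transfer operators commute
    (∀ (n : ℕ) (p p' : ℂ),
      ExteriorIntegrability.transfer n p * ExteriorIntegrability.transfer n p'
        = ExteriorIntegrability.transfer n p' * ExteriorIntegrability.transfer n p) := by
  refine ⟨fun x y hx => ⟨?_, ?_, ?_, ?_⟩, ?_⟩
  · exact ExteriorIntegrability.isExpOf_rMatrix x y
  · exact ExteriorIntegrability.rMatrix_rll hx y
  · exact ExteriorIntegrability.rMatrix_vacuum _ _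
  · exact ExteriorIntegrability.vacuum_rMatrix _ _
  · exact ExteriorIntegrability.transfer_commute
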